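/- Let $q\ge2$, $a>0$ and $\mathbf x_0=(x_1,\dots,x_q)\in(0,\infty)^q$. For $\mathbf x\in\mathbb R^q$ put $|\mathbf x|:=\sum_i|x_i|$, and let $\mathbf e_1,\dots,\mathbf e_q$ be the unit vectors. Let $(\mathbf X_n)_{n\ge0}$ be the $q$-colour Pólya urn with initial composition $\mathbf x_0$ and replacement $a$, that is, the Markov chain in $\mathbb R^q$ with $\mathbf X_0=\mathbf x_0$ and $$\mathbb P(\mathbf X_{n+1}=\mathbf X_n+a\mathbf e_i\mid \mathbf X_n)=\frac{X_{n,i}}{|\mathbf X_n|},\qquad i=1,\dots,q,$$ and let $\mathbf Y_n=(Y_{n,1},\dots,Y_{n,q})$, where $Y_{n,i}$ is the number of $k\in\{1,\dots,n\}$ with $\mathbf X_k=\mathbf X_{k-1}+a\mathbf e_i$ (the number of the first $n$ drawn balls that have colour $i$). Let $\mathbf W\sim\mathrm{Dir}(\alpha_1,\dots,\alpha_q)$ with $\alpha_i=x_i/a$, i.e. $\mathbf W$ has the distribution on $\{\mathbf w\in(0,\infty)^q:\sum_i w_i=1\}$ with density $\frac{\Gamma(\alpha_1+\dots+\alpha_q)}{\Gamma(\alpha_1)\cdots\Gamma(\alpha_q)}\,w_1^{\alpha_1-1}\cdots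 w_q^{\alpha_q-1}$ with respect to $dw_1\cdots dw_{q-1}$. For $p\in[1,\infty]$ and random vectors $\mathbf U,\mathbf V$ in $\mathbb R^q$ let $$\ell_p(\mathbf U,\mathbf V):=\inf\bigl\{\bigl\||\mathbf U'-\mathbf V'|\bigr\|_{L_p}:\ \mathbf U'\overset{d}{=}\mathbf U,\ \mathbf V'\overset{d}{=}\mathbf V\bigr\},$$ the infimum over all couplings, where $\|\cdot\|_{L_\infty}$ is the essential supremum. Then there are constants $c,C>0$, depending only on $q$, $a$ and $\mathbf x_0$, such that for every $p\in[1,\infty]$ and every $n\ge1$, $$\frac cn\le \ell_p\Bigl(\frac{\mathbf X_n}{|\mathbf X_n|},\mathbf W\Bigr)\le\frac Cn\qquad\text{and}\qquad \frac cn\le \ell_p\Bigl(\frac{\mathbf Y_n}{n},\mathbf W\Bigr)\le\frac Cn .$$ -/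

import Mathlib

open MeasureTheory ProbabilityTheory
open scoped ENNReal

/-- `X 0, X 1, …` is the sequence of compositions of a Pólya urn with `q` colours, replacement `a`
and initial composition `x₀`: the Markov chain started at `x₀` that moves from a composition `s` to
`s + a eᵢ` with probability `sᵢ / |s|`. Conditioning is on the whole history up to time `n`. -/
structure IsPolyaUrn {q : ℕ} {Ω : Type*} [MeasurableSpace Ω] (a : ℝ) (x₀ : Fin q → ℝ)
    (P : Measure Ω) (X : ℕ → Ω → Fin q → ℝ) : Prop where
  measurable : ∀ n, Measurable (X n)
  initial : ∀ᵐ ω ∂P, X 0 ω = x₀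
  step : ∀ (n : ℕ) (s : ℕ → Fin q → ℝ) (i : Fin q),
    P {ω | ∀ k ≤ n, X k ω = s k} ≠ 0 →
      P[{ω | X (n + 1) ω = s n + Pi.single i a} | {ω | ∀ k ≤ n, X k ω = s k}]
        = ENNReal.ofReal (s n i / ∑ j, s n j)

open Classical in
/-- `drawCount a X n ω i` is the number of the first `n` drawn balls that have colour `i`; the ball
drawn at step `k + 1` has colour `i` when `a` balls of colour `i` are then added. -/
noncomputable def drawCount {q : ℕ} {Ω : Type*} (a : ℝ) (X : ℕ → Ω → Fin q → ℝ)
    (n : ℕ) (ω : Ω) (i : Fin q) : ℕ :=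
  ((Finset.range n).filter fun k => X (k + 1) ω = X k ω + Pi.single i a).card

/-- The point `(y₁, …, y_{q-1}, 1 - ∑ yᵢ)` of the hyperplane `∑ xᵢ = 1` in `ℝ^q`. -/
def simplexPoint {q : ℕ} (y : Fin (q - 1) → ℝ) (i : Fin q) : ℝ :=
  if h : (i : ℕ) < q - 1 then y ⟨i, h⟩ else 1 - ∑ j, y j

open Classical in
/-- The density of the Dirichlet distribution with respect to `dx₁ ⋯ dx_{q-1}`. -/
noncomputable def dirichletPDF {q : ℕ} (α : Fin q → ℝ) (y : Fin (q - 1) → ℝ) : ℝ≥0∞ :=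
  ENNReal.ofReal
    (if ∀ i : Fin q, 0 < simplexPoint y i then
      Real.Gamma (∑ i, α i) / (∏ i, Real.Gamma (α i)) * ∏ i, simplexPoint y i ^ (α i - 1)
    else 0)

/-- The Dirichlet distribution `Dir(α₁, …, α_q)` on `ℝ^q`. -/
noncomputable def dirichletMeasure {q : ℕ} (α : Fin q → ℝ) : Measure (Fin q → ℝ) :=
  ((volume : Measure (Fin (q - 1) → ℝ)).withDensity (dirichletPDF α)).map simplexPoint

/-- `π` is a coupling of `μ` and `ν`. -/
structure IsCoupling {E : Type*} [MeasurableSpace E] (μ ν : Measure E) (π : Measure (E × E)) :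
    Prop where
  map_fst : π.map Prod.fst = μ
  map_snd : π.map Prod.snd = ν

/-- The minimal `L_p` distance between two probability distributions on `ℝ^q`: the infimum, over all
couplings, of the `L_p` norm of `|x - y| = ∑ᵢ |xᵢ - yᵢ|` (for `p = ∞`, its essential supremum). -/
noncomputable def minimalLp {q : ℕ} (p : ℝ≥0∞) (μ ν : Measure (Fin q → ℝ)) : ℝ≥0∞ :=
  ⨅ (π : Measure ((Fin q → ℝ) × (Fin q → ℝ))) (_ : IsCoupling μ ν π),
    eLpNorm (fun z : (Fin q → ℝ) × (Fin q → ℝ) => ∑ i, |z.1 i - z.2 i|) p π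

/-! Upper bound. It suffices to couple the draw counts with the Dirichlet vector so that `∑ i, |Y i
- n * W i|` is almost surely bounded by a constant not depending on `n` (`exists_urn_coupling`).
Dividing by `n`, or by the total weight of the urn, then bounds the essential supremum by `C / n`,
and hence every `L_p` norm.

The coupling is built by induction on the number of colours. A Dirichlet vector is a beta variable
followed by a rescaled Dirichlet vector on the remaining colours (stick-breaking). Likewise, the
first count is beta-binomial, and given its value `k` the remaining counts are those of an urn after
`n - k` draws. So the problem reduces to two colours: the quantile coupling of the beta-binomial law
with the beta law must have bounded error after scaling by `n + 1`.

For two colours, let `S_m` be the piecewise linear interpolation of the beta-binomial distribution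
function with `m` trials. For a suitable constant `D`, the value `S_m((m + 1) z - D)` does not
decrease when `m` grows. This follows from the relation between `m` and `m + 1` trials and a bound
on the difference of neighbouring masses (`linInterp_betaBinomialCum_le_succ`). As `m` tends to
infinity, Bernstein approximation bounds these values by the beta distribution function slightly to
the right of `z`, which gives `betaBinomialCum_le_cdf`. Exchanging successes and failures gives the
reverse comparison.

Lower bound. The first coordinate of either normalised vector lies in a translated lattice whose
spacing is of order `1 / n`, while the first Dirichlet coordinate has a beta density bounded below
on a compact interval. Its mean distance to any such lattice is therefore at least a constant times
the spacing (`exists_le_minimalLp`). This bounds the `L_1` distance, and so every `L_p` distance,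
from below. -/

/-! ### Rising weights and beta-binomial masses. -/

/-- The coefficient of `xᵏ` in `(1 - x)^(-α)`, that is, `α (α + 1) ⋯ (α + k - 1) / k!`. -/
noncomputable def risingWeight (α : ℝ) (k : ℕ) : ℝ :=
  ∏ j ∈ Finset.range k, (α + j) / (j + 1)

@[simp] lemma risingWeight_zero (α : ℝ) : risingWeight α 0 = 1 := by simp [risingWeight]

lemma risingWeight_succ (α : ℝ) (k : ℕ) :
    risingWeight α (k + 1) = risingWeight α k * ((α + k) / (k + 1)) := by
  rw [risingWeight, Finset.prod_range_succ, risingWeight]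

lemma risingWeight_succ_mul (α : ℝ) (k : ℕ) :
    risingWeight α (k + 1) * (k + 1) = risingWeight α k * (α + k) := by
  rw [risingWeight_succ]; field_simp

lemma risingWeight_pos {α : ℝ} (hα : 0 < α) (k : ℕ) : 0 < risingWeight α k :=
  Finset.prod_pos fun _ _ => by positivity

lemma Gamma_add_nat_eq {α : ℝ} (hα : 0 < α) (k : ℕ) :
    Real.Gamma (α + k) = Real.Gamma α * (k.factorial * risingWeight α k) := by
  induction k with
  | zero => simp
  | succ k ih =>
    have h : α + k ≠ 0 := by positivity
    rw [Nat.cast_succ, ← add_assoc, Real.Gamma_add_one h, ih, Nat.factorial_succ,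
      risingWeight_succ]
    push_cast
    field_simp

/-- The beta-binomial probability of `k` successes among `n`. -/
noncomputable def betaBinomial (α β : ℝ) (n k : ℕ) : ℝ :=
  if k ≤ n then risingWeight α k * risingWeight β (n - k) / risingWeight (α + β) n else 0

lemma betaBinomial_of_lt (α β : ℝ) {n k : ℕ} (h : n < k) : betaBinomial α β n k = 0 :=
  if_neg (by omega)

lemma betaBinomial_add (α β : ℝ) (k l : ℕ) :
    betaBinomial α β (k + l) k
      = risingWeight α k * risingWeight β l / risingWeight (α + β) (k + l) := by
  simp [betaBinomial]

lemma betaBinomial_pos {α β : ℝ} (hα : 0 < α) (hβ : 0 < β) {n k : ℕ} (h : k ≤ n) :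
    0 < betaBinomial α β n k := by
  rw [betaBinomial, if_pos h]
  have := risingWeight_pos hα k
  have := risingWeight_pos hβ (n - k)
  have := risingWeight_pos (add_pos hα hβ) n
  positivity

lemma betaBinomial_nonneg {α β : ℝ} (hα : 0 < α) (hβ : 0 < β) (n k : ℕ) :
    0 ≤ betaBinomial α β n k := by
  rcases le_or_gt k n with h | h
  · exact (betaBinomial_pos hα hβ h).le
  · rw [betaBinomial_of_lt α β h]

lemma betaBinomial_symm (α β : ℝ) {n k : ℕ} (h : k ≤ n) :
    betaBinomial α β n k = betaBinomial β α n (n - k) := by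
  rw [betaBinomial, if_pos h, betaBinomial, if_pos (by omega), Nat.sub_sub_self h, add_comm β α]
  ring

/-- Deleting a uniformly chosen trial. -/
lemma betaBinomial_eq_succ {α β : ℝ} (hα : 0 < α) (hβ : 0 < β) {n j : ℕ} (h : j ≤ n) :
    (n + 1) * betaBinomial α β n j
      = (n + 1 - j) * betaBinomial α β (n + 1) j
        + (j + 1) * betaBinomial α β (n + 1) (j + 1) := by
  obtain ⟨l, rfl⟩ := Nat.exists_eq_add_of_le h
  rw [betaBinomial_add, show j + l + 1 = j + (l + 1) by ring, betaBinomial_add,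
    show j + (l + 1) = (j + 1) + l by ring, betaBinomial_add]
  have h1 := risingWeight_succ_mul α j
  have h2 := risingWeight_succ_mul β l
  have h3 := risingWeight_succ_mul (α + β) (j + l)
  rw [show j + l + 1 = (j + 1) + l by ring] at h3
  have p1 := (risingWeight_pos (add_pos hα hβ) (j + l)).ne'
  have p2 := (risingWeight_pos (add_pos hα hβ) (j + 1 + l)).ne'
  push_cast at h3 ⊢
  field_simp
  linear_combination (-risingWeight α j * risingWeight (α + β) (j + l)) * h2
    + (-risingWeight β l * risingWeight (α + β) (j + l)) * h1
    + risingWeight α j * risingWeight β l * h3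

lemma betaBinomial_ratio {α β : ℝ} (hα : 0 < α) (hβ : 0 < β) {n j : ℕ} (h : j ≤ n) :
    (j + 1) * (β + (n - j)) * betaBinomial α β (n + 1) (j + 1)
      = (α + j) * (n + 1 - j) * betaBinomial α β (n + 1) j := by
  obtain ⟨l, rfl⟩ := Nat.exists_eq_add_of_le h
  rw [show j + l + 1 = j + (l + 1) by ring, betaBinomial_add,
    show j + (l + 1) = (j + 1) + l by ring, betaBinomial_add]
  have h1 := risingWeight_succ_mul α j
  have h2 := risingWeight_succ_mul β l
  have p2 := (risingWeight_pos (add_pos hα hβ) (j + 1 + l)).ne'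
  push_cast
  field_simp
  linear_combination (risingWeight β l * (β + l)) * h1 - risingWeight α j * (α + j) * h2

lemma betaBinomial_eq_beta {α β : ℝ} (hα : 0 < α) (hβ : 0 < β) {n k : ℕ} (h : k ≤ n) :
    betaBinomial α β n k = n.choose k * (beta (α + k) (β + (n - k : ℕ)) / beta α β) := by
  obtain ⟨l, rfl⟩ := Nat.exists_eq_add_of_le h
  rw [betaBinomial_add, Nat.add_sub_cancel_left, beta, beta, Gamma_add_nat_eq hα,
    Gamma_add_nat_eq hβ, show α + k + (β + l) = (α + β) + (k + l : ℕ) by push_cast; ring,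
    Gamma_add_nat_eq (add_pos hα hβ), Nat.choose_symm_add, Nat.add_choose, Nat.cast_div
      (Nat.factorial_mul_factorial_dvd_factorial_add k l) (by positivity)]
  have := risingWeight_pos (add_pos hα hβ) (k + l)
  have := Real.Gamma_pos_of_pos hα
  have := Real.Gamma_pos_of_pos hβ
  have := Real.Gamma_pos_of_pos (add_pos hα hβ)
  have := Nat.factorial_pos k
  have := Nat.factorial_pos l
  have := Nat.factorial_pos (k + l)
  push_cast
  field_simp

/-! ### Beta-binomial laws as beta mixtures of binomial laws. -/

lemma ae_betaMeasure_mem_Ioo (α β : ℝ) : ∀ᵐ b ∂betaMeasure α β, b ∈ Set.Ioo (0 : ℝ) 1 := by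
  rw [betaMeasure, ae_withDensity_iff (by unfold betaPDF; fun_prop)]
  refine Filter.Eventually.of_forall fun b hb => ?_
  constructor
  · by_contra h
    exact hb (betaPDF_eq_zero_of_nonpos (not_lt.1 h))
  · by_contra h
    exact hb (betaPDF_eq_zero_of_one_le (not_lt.1 h))

lemma lintegral_betaMeasure (α β : ℝ) {f : ℝ → ℝ≥0∞} (hf : Measurable f) :
    ∫⁻ b, f b ∂betaMeasure α β = ∫⁻ b, betaPDF α β b * f b := by
  rw [betaMeasure, lintegral_withDensity_eq_lintegral_mul _ (by unfold betaPDF; fun_prop) hf]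
  rfl

lemma lintegral_pow_mul_pow_betaMeasure {α β : ℝ} (hα : 0 < α) (hβ : 0 < β) (k l : ℕ) :
    ∫⁻ b, ENNReal.ofReal (b ^ k * (1 - b) ^ l) ∂betaMeasure α β
      = ENNReal.ofReal (beta (α + k) (β + l) / beta α β) := by
  have hB := beta_pos hα hβ
  have hB' : 0 < beta (α + k) (β + l) := beta_pos (by positivity) (by positivity)
  rw [lintegral_betaMeasure _ _ (by fun_prop)]
  have h : ∀ b, betaPDF α β b * ENNReal.ofReal (b ^ k * (1 - b) ^ l)
      = ENNReal.ofReal (beta (α + k) (β + l) / beta α β) * betaPDF (α + k) (β + l) b := by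
    intro b
    simp only [betaPDF_eq]
    split_ifs with hb
    · have h1 : 0 < b := hb.1
      have h2 : 0 < 1 - b := by linarith [hb.2]
      rw [← ENNReal.ofReal_mul (by positivity), ← ENNReal.ofReal_mul (by positivity)]
      congr 1
      rw [show α + k - 1 = α - 1 + k by ring, show β + l - 1 = β - 1 + l by ring,
        Real.rpow_add h1, Real.rpow_add h2, Real.rpow_natCast, Real.rpow_natCast]
      field_simp
    · simp
  simp_rw [h]
  rw [lintegral_const_mul _ (by unfold betaPDF; fun_prop),
    lintegral_betaPDF_eq_one (by positivity) (by positivity), mul_one]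

/-- Averaging a binomial law over a beta-distributed success probability produces the beta-binomial
law. The integrands are Bernstein polynomials, so their summing to one gives the normalisation and
their approximation property gives the weak limit. -/
lemma integral_bernstein_betaMeasure {α β : ℝ} (hα : 0 < α) (hβ : 0 < β) {n k : ℕ} (h : k ≤ n) :
    ∫ b, n.choose k * b ^ k * (1 - b) ^ (n - k) ∂betaMeasure α β = betaBinomial α β n k := by
  simp_rw [mul_assoc]
  rw [integral_const_mul, integral_eq_lintegral_of_nonneg_ae,
    lintegral_pow_mul_pow_betaMeasure hα hβ, ENNReal.toReal_ofReal, betaBinomial_eq_beta hα hβ h]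
  · have := beta_pos hα hβ
    have : 0 < beta (α + k) (β + (n - k : ℕ)) := beta_pos (by positivity) (by positivity)
    positivity
  · filter_upwards [ae_betaMeasure_mem_Ioo α β] with b hb
    have : 0 < b := hb.1
    have : 0 < 1 - b := by linarith [hb.2]
    simp only [Pi.zero_apply]
    positivity
  · exact Measurable.aestronglyMeasurable (by fun_prop)

lemma integrable_bernstein_betaMeasure {α β : ℝ} (hα : 0 < α) (hβ : 0 < β) (n k : ℕ) :
    Integrable (fun b : ℝ => n.choose k * b ^ k * (1 - b) ^ (n - k)) (betaMeasure α β) := by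
  have := isProbabilityMeasureBeta hα hβ
  refine Integrable.of_bound (Measurable.aestronglyMeasurable (by fun_prop)) (n.choose k) ?_
  filter_upwards [ae_betaMeasure_mem_Ioo α β] with b hb
  have h1 : 0 < b := hb.1
  have h2 : 0 < 1 - b := by linarith [hb.2]
  rw [Real.norm_of_nonneg (by positivity), mul_assoc]
  refine mul_le_of_le_one_right (by positivity) (mul_le_one₀ (pow_le_one₀ h1.le hb.2.le)
    (by positivity) (pow_le_one₀ h2.le (by linarith)))

lemma sum_betaBinomial {α β : ℝ} (hα : 0 < α) (hβ : 0 < β) (n : ℕ) :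
    ∑ k ∈ Finset.range (n + 1), betaBinomial α β n k = 1 := by
  have := isProbabilityMeasureBeta hα hβ
  calc ∑ k ∈ Finset.range (n + 1), betaBinomial α β n k
      = ∑ k ∈ Finset.range (n + 1), ∫ b : ℝ, n.choose k * b ^ k * (1 - b) ^ (n - k)
          ∂betaMeasure α β :=
        Finset.sum_congr rfl fun k hk => (integral_bernstein_betaMeasure hα hβ
          (Nat.lt_succ_iff.1 (Finset.mem_range.1 hk))).symm
    _ = ∫ b : ℝ, ∑ k ∈ Finset.range (n + 1), n.choose k * b ^ k * (1 - b) ^ (n - k)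
          ∂betaMeasure α β :=
        (integral_finsetSum _ fun k _ => integrable_bernstein_betaMeasure hα hβ n k).symm
    _ = ∫ b : ℝ, 1 ∂betaMeasure α β := by
        congr 1; ext b
        have h := add_pow b (1 - b) n
        rw [add_sub_cancel, one_pow] at h
        refine Eq.trans ?_ h.symm
        exact Finset.sum_congr rfl fun k _ => by ring
    _ = 1 := by simp

/-- The beta-binomial distributions, rescaled, converge weakly to the beta distribution. -/
lemma tendsto_sum_betaBinomial {α β : ℝ} (hα : 0 < α) (hβ : 0 < β) {f : ℝ → ℝ}
    (hf : Continuous f) :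
    Filter.Tendsto (fun m : ℕ => ∑ k ∈ Finset.range (m + 1), f (k / m) * betaBinomial α β m k)
      Filter.atTop (nhds (∫ b, f b ∂betaMeasure α β)) := by
  have := isProbabilityMeasureBeta hα hβ
  let g : C(unitInterval, ℝ) := ⟨fun x => f x, by fun_prop⟩
  have key := bernsteinApproximation_uniform g
  rw [Metric.tendsto_atTop] at key ⊢
  intro ε hε
  obtain ⟨M, hM⟩ := key (ε / 2) (by positivity)
  refine ⟨M, fun m hm => ?_⟩
  have hsum : ∑ k ∈ Finset.range (m + 1), f (k / m) * betaBinomial α β m k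
      = ∫ b : ℝ, ∑ k ∈ Finset.range (m + 1),
          f (k / m) * (m.choose k * b ^ k * (1 - b) ^ (m - k)) ∂betaMeasure α β := by
    rw [integral_finsetSum _ fun k _ =>
      (integrable_bernstein_betaMeasure hα hβ m k).const_mul _]
    refine Finset.sum_congr rfl fun k hk => ?_
    rw [integral_const_mul, integral_bernstein_betaMeasure hα hβ
          (Nat.lt_succ_iff.1 (Finset.mem_range.1 hk))]
  have hfi : Integrable f (betaMeasure α β) := by
    obtain ⟨C, hC⟩ := (isCompact_Icc (a := (0 : ℝ)) (b := 1)).exists_bound_of_continuousOn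
      hf.continuousOn
    refine Integrable.of_bound hf.aestronglyMeasurable C ?_
    filter_upwards [ae_betaMeasure_mem_Ioo α β] with b hb
    exact hC b (Set.Ioo_subset_Icc_self hb)
  rw [hsum, dist_eq_norm, ← integral_sub (integrable_finsetSum _ fun k _ =>
      (integrable_bernstein_betaMeasure hα hβ m k).const_mul _) hfi]
  refine lt_of_le_of_lt (norm_integral_le_of_norm_le_const (C := ε / 2) ?_) (by simp; linarith)
  filter_upwards [ae_betaMeasure_mem_Ioo α β] with b hb
  have h1 := hM m hm
  have h2 := (ContinuousMap.dist_lt_iff (by positivity)).1 h1 ⟨b, Set.Ioo_subset_Icc_self hb⟩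
  rw [dist_eq_norm] at h2
  refine le_trans (le_of_eq ?_) h2.le
  congr 2
  rw [bernsteinApproximation, ContinuousMap.sum_apply, Finset.sum_range]
  refine Finset.sum_congr rfl fun k _ => ?_
  simp [bernstein_apply, g, bernstein.z, mul_comm]

/-! ### Interpolated distribution functions and their monotonicity in the number of trials. -/

/-- The piecewise linear interpolation of a sequence. -/
noncomputable def linInterp (S : ℕ → ℝ) (t : ℝ) : ℝ :=
  S ⌊t⌋₊ + (t - ⌊t⌋₊) * (S (⌊t⌋₊ + 1) - S ⌊t⌋₊)

lemma linInterp_natCast (S : ℕ → ℝ) (k : ℕ) : linInterp S k = S k := by simp [linInterp]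

lemma linInterp_eq (S : ℕ → ℝ) {j : ℕ} {t : ℝ} (h1 : j ≤ t) (h2 : t ≤ j + 1) :
    linInterp S t = S j + (t - j) * (S (j + 1) - S j) := by
  rcases h2.eq_or_lt with rfl | h2
  · rw [← Nat.cast_succ, linInterp_natCast]; push_cast; ring
  · have : ⌊t⌋₊ = j := (Nat.floor_eq_iff (by linarith [j.cast_nonneg (α := ℝ)])).2 ⟨h1, h2⟩
    rw [linInterp, this]

lemma linInterp_le_floor_succ {S : ℕ → ℝ} (hS : Monotone S) {t : ℝ} :
    linInterp S t ≤ S (⌊t⌋₊ + 1) := by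
  have h2 := (Nat.lt_floor_add_one t).le
  have := hS (Nat.le_succ ⌊t⌋₊)
  rw [linInterp]
  simp only [Nat.succ_eq_add_one] at this
  nlinarith

lemma floor_le_linInterp {S : ℕ → ℝ} (hS : Monotone S) {t : ℝ} (ht : 0 ≤ t) :
    S ⌊t⌋₊ ≤ linInterp S t := by
  have := hS (Nat.le_succ ⌊t⌋₊)
  exact le_add_of_nonneg_right (mul_nonneg (sub_nonneg.2 (Nat.floor_le ht)) (sub_nonneg.2 this))

lemma linInterp_mono {S : ℕ → ℝ} (hS : Monotone S) {s t : ℝ} (hs : 0 ≤ s) (hst : s ≤ t) :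
    linInterp S s ≤ linInterp S t := by
  rcases (Nat.floor_mono hst).eq_or_lt with h | h
  · rw [linInterp, linInterp, ← h]
    have := hS (Nat.le_succ ⌊s⌋₊)
    simp only [Nat.succ_eq_add_one] at this
    nlinarith
  · exact (linInterp_le_floor_succ hS).trans ((hS h).trans (floor_le_linInterp hS (hs.trans hst)))

/-- The probability of fewer than `k` successes under the beta-binomial distribution. -/
noncomputable def betaBinomialCum (α β : ℝ) (n k : ℕ) : ℝ :=
  ∑ j ∈ Finset.range k, betaBinomial α β n j

@[simp] lemma betaBinomialCum_zero (α β : ℝ) (n : ℕ) : betaBinomialCum α β n 0 = 0 := by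
  simp [betaBinomialCum]

lemma betaBinomialCum_succ (α β : ℝ) (n k : ℕ) :
    betaBinomialCum α β n (k + 1) = betaBinomialCum α β n k + betaBinomial α β n k :=
  Finset.sum_range_succ _ _

lemma betaBinomialCum_mono {α β : ℝ} (hα : 0 < α) (hβ : 0 < β) (n : ℕ) :
    Monotone (betaBinomialCum α β n) :=
  monotone_nat_of_le_succ fun k => by
    rw [betaBinomialCum_succ]; linarith [betaBinomial_nonneg hα hβ n k]

lemma betaBinomialCum_of_lt {α β : ℝ} (hα : 0 < α) (hβ : 0 < β) {n k : ℕ} (h : n < k) :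
    betaBinomialCum α β n k = 1 := by
  obtain ⟨d, rfl⟩ := Nat.exists_eq_add_of_lt h
  induction d with
  | zero => exact sum_betaBinomial hα hβ n
  | succ d ih =>
    rw [show n + (d + 1) + 1 = (n + d + 1) + 1 by ring, betaBinomialCum_succ, ih (by omega),
      betaBinomial_of_lt _ _ (by omega), add_zero]

lemma betaBinomialCum_le_one {α β : ℝ} (hα : 0 < α) (hβ : 0 < β) (n k : ℕ) :
    betaBinomialCum α β n k ≤ 1 :=
  (betaBinomialCum_mono hα hβ n (le_max_left k (n + 1))).trans
    (betaBinomialCum_of_lt hα hβ (by omega)).le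

lemma betaBinomialCum_nonneg {α β : ℝ} (hα : 0 < α) (hβ : 0 < β) (n k : ℕ) :
    0 ≤ betaBinomialCum α β n k :=
  Finset.sum_nonneg fun j _ => betaBinomial_nonneg hα hβ n j

/-- Delete a uniformly chosen trial out of `n + 1`. The count falls below `j` if it was already
below `j`, or if it was exactly `j` and a success was deleted, which has conditional probability `j
/ (n + 1)`. -/
lemma betaBinomialCum_succ_trials {α β : ℝ} (hα : 0 < α) (hβ : 0 < β) {n j : ℕ}
    (h : j ≤ n + 1) :
    betaBinomialCum α β (n + 1) j
      = betaBinomialCum α β n j - j / (n + 1) * betaBinomial α β (n + 1) j := by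
  induction j with
  | zero => simp
  | succ j ih =>
    have h1 := betaBinomial_eq_succ hα hβ (n := n) (j := j) (by omega)
    rw [betaBinomialCum_succ, betaBinomialCum_succ, ih (by omega)]
    push_cast
    field_simp
    linear_combination -h1

lemma betaBinomialCum_symm {α β : ℝ} (hα : 0 < α) (hβ : 0 < β) {n k : ℕ} (h : k ≤ n + 1) :
    1 - betaBinomialCum α β n k = betaBinomialCum β α n (n + 1 - k) := by
  rw [← betaBinomialCum_of_lt hα hβ (Nat.lt_succ_self n), betaBinomialCum, betaBinomialCum,
    betaBinomialCum, Nat.succ_eq_add_one, ← Finset.sum_range_add_sum_Ico _ h, add_sub_cancel_left,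
    Finset.sum_Ico_eq_sum_range, ← Finset.sum_range_reflect]
  refine Finset.sum_congr rfl fun j hj => ?_
  have hj' := Finset.mem_range.1 hj
  rw [betaBinomial_symm α β (by omega)]
  congr 1
  omega

/-- A bound for the displacement between the beta-binomial quantiles for `n` and `n + 1` trials. -/
noncomputable def betaShift (α β : ℝ) : ℝ :=
  (|α - 1| + |β - 1|) / min 1 (min α β)

lemma betaShift_nonneg {α β : ℝ} (hα : 0 < α) (hβ : 0 < β) : 0 ≤ betaShift α β := by
  have : 0 < min 1 (min α β) := by simp [hα, hβ]
  unfold betaShift; positivity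

lemma betaShift_comm (α β : ℝ) : betaShift α β = betaShift β α := by
  rw [betaShift, betaShift, min_comm α β, add_comm]

/-- With `l = n - j`, the ratio of neighbouring masses turns their difference into `(α - 1) * (l +
1) - (β - 1) * (j + 1)` times one of them, over a denominator. The numerator is at most `(|α - 1| +
|β - 1|) * (n + 2)`, and the minimum in `betaShift` comes from comparing `β + l` with `l + 1` and `α
+ j` with `j + 1`. The two versions serve the two linear pieces in the next lemma. -/
lemma betaBinomial_diff_le {α β : ℝ} (hα : 0 < α) (hβ : 0 < β) {n j : ℕ} (h : j ≤ n) :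
    (j + 1) * (n + 1 - j) *
        (betaBinomial α β (n + 1) (j + 1) - betaBinomial α β (n + 1) j)
      ≤ (n + 2) * betaShift α β * betaBinomial α β (n + 1) j ∧
    (j + 1) * (n + 1 - j) *
        (betaBinomial α β (n + 1) (j + 1) - betaBinomial α β (n + 1) j)
      ≤ (n + 2) * betaShift α β * betaBinomial α β (n + 1) (j + 1) := by
  have hu := betaBinomial_pos hα hβ (n := n + 1) (k := j) (by omega)
  have hv := betaBinomial_pos hα hβ (n := n + 1) (k := j + 1) (by omega)
  have hr := betaBinomial_ratio hα hβ h
  set u := betaBinomial α β (n + 1) j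
  set v := betaBinomial α β (n + 1) (j + 1)
  obtain ⟨l, rfl⟩ := Nat.exists_eq_add_of_le h
  push_cast at hr ⊢
  have e1 : (j : ℝ) + l - j = l := by ring
  have e2 : (j : ℝ) + l + 1 - j = l + 1 := by ring
  rw [e1, e2] at hr
  rw [e2]
  set m := min 1 (min α β)
  have hm : 0 < m := by simp [m, hα, hβ]
  have hm1 : m ≤ 1 := min_le_left _ _
  have hma : m ≤ α := (min_le_right _ _).trans (min_le_left _ _)
  have hmb : m ≤ β := (min_le_right _ _).trans (min_le_right _ _)
  have hK : betaShift α β * m = |α - 1| + |β - 1| := by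
    rw [betaShift]; exact div_mul_cancel₀ _ hm.ne'
  have hD := betaShift_nonneg hα hβ
  set D := betaShift α β
  have hj : (0 : ℝ) ≤ j := j.cast_nonneg
  have hl : (0 : ℝ) ≤ l := l.cast_nonneg
  set A := (α - 1) * (l + 1) - (β - 1) * (j + 1) with hA
  have hAle : A ≤ D * m * (j + l + 2) := by
    rw [hK]
    have := le_abs_self (α - 1)
    have := neg_abs_le (β - 1)
    have := abs_nonneg (α - 1)
    have := abs_nonneg (β - 1)
    nlinarith
  have hDm : 0 ≤ D * m := by positivity
  constructor
  · have h1 : (j + 1) * (β + l) * (v - u) = A * u := by rw [hA]; linear_combination hr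
    have hb : m * (l + 1) ≤ β + l := by nlinarith
    have hbl : 0 < β + l := by positivity
    have h2 : (j + 1) * (l + 1) * (v - u) * (β + l)
        ≤ (j + l + 2) * D * u * (β + l) := by
      calc (j + 1) * (l + 1) * (v - u) * (β + l) = (l + 1) * (A * u) := by
            rw [← h1]; ring
        _ ≤ (l + 1) * (D * m * (j + l + 2) * u) := by gcongr
        _ = (j + l + 2) * D * u * (m * (l + 1)) := by ring
        _ ≤ _ := by gcongr
    exact le_of_mul_le_mul_right h2 hbl
  · have h1 : (α + j) * (l + 1) * (v - u) = A * v := by rw [hA]; linear_combination hr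
    have hb : m * (j + 1) ≤ α + j := by nlinarith
    have hbl : 0 < α + j := by positivity
    have h2 : (j + 1) * (l + 1) * (v - u) * (α + j)
        ≤ (j + l + 2) * D * v * (α + j) := by
      calc (j + 1) * (l + 1) * (v - u) * (α + j) = (j + 1) * (A * v) := by
            rw [← h1]; ring
        _ ≤ (j + 1) * (D * m * (j + l + 2) * v) := by gcongr
        _ = (j + l + 2) * D * v * (m * (j + 1)) := by ring
        _ ≤ _ := by gcongr
    exact le_of_mul_le_mul_right h2 hbl

-- On `[j, j + 1]` the left side is affine, with slope a weighted mean of the masses `u` and `v` at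
-- `j` and `j + 1` for `n + 1` trials. It is compared with the two affine pieces of the right side,
-- of slopes `u` and `v`. Stretching by `(n + 2) / (n + 1)` matches the scales, and the extra shift
-- pays for the difference `v - u`.
set_option maxHeartbeats 800000 in
lemma linInterp_betaBinomialCum_le_succ {α β : ℝ} (hα : 0 < α) (hβ : 0 < β) (n : ℕ) {t : ℝ}
    (ht : 0 ≤ t) :
    linInterp (betaBinomialCum α β n) t
      ≤ linInterp (betaBinomialCum α β (n + 1))
          (t * (n + 2) / (n + 1) + betaShift α β / (n + 1)) := by
  have hD := betaShift_nonneg hα hβ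
  have hmono := betaBinomialCum_mono hα hβ (n + 1)
  set D := betaShift α β
  set y := t * (n + 2) / (n + 1) + D / (n + 1) with hy
  have hN : (0 : ℝ) < n + 1 := by positivity
  have hy' : y * (n + 1) = t * (n + 2) + D := by rw [hy]; field_simp
  -- Past the last possible count both functions have reached one.
  rcases le_or_gt (n + 1 : ℝ) t with htn | htn
  · have h1 : (n + 2 : ℕ) ≤ y := by
      push_cast
      by_contra hc
      nlinarith [not_le.1 hc]
    calc _ ≤ betaBinomialCum α β n (⌊t⌋₊ + 1) :=
          linInterp_le_floor_succ (betaBinomialCum_mono hα hβ n)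
      _ ≤ 1 := betaBinomialCum_le_one hα hβ _ _
      _ = linInterp (betaBinomialCum α β (n + 1)) (n + 2 : ℕ) := by
          rw [linInterp_natCast, betaBinomialCum_of_lt hα hβ (by omega)]
      _ ≤ _ := linInterp_mono hmono (Nat.cast_nonneg _) h1
  obtain ⟨j, hj⟩ : ∃ j, j = ⌊t⌋₊ := ⟨_, rfl⟩
  have hj1 : (j : ℝ) ≤ t := hj ▸ Nat.floor_le ht
  have hj2 : t < j + 1 := hj ▸ Nat.lt_floor_add_one t
  have hjn : j ≤ n := by
    have : (j : ℝ) < (n + 1 : ℕ) := by push_cast; linarith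
    exact Nat.lt_succ_iff.1 (Nat.cast_lt.1 this)
  have hjn' : (j : ℝ) ≤ n := Nat.cast_le.2 hjn
  have hjy : (j : ℝ) ≤ y := by
    by_contra hc
    linarith [mul_lt_mul_of_pos_right (not_le.1 hc) hN, mul_le_mul_of_nonneg_right hj1 hN.le]
  have hu := betaBinomial_pos hα hβ (n := n + 1) (k := j) (by omega)
  have hv := betaBinomial_pos hα hβ (n := n + 1) (k := j + 1) (by omega)
  obtain ⟨hd1, hd2⟩ := betaBinomial_diff_le hα hβ hjn
  have hp := betaBinomial_eq_succ hα hβ hjn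
  have hS1 := betaBinomialCum_succ_trials hα hβ (n := n) (j := j) (by omega)
  have hS2 := betaBinomialCum_succ_trials hα hβ (n := n) (j := j + 1) (by omega)
  have eL : linInterp (betaBinomialCum α β n) t
      = betaBinomialCum α β n j + (t - j) * betaBinomial α β n j := by
    rw [linInterp_eq _ hj1 hj2.le, betaBinomialCum_succ]; ring
  have eL2 : linInterp (betaBinomialCum α β n) t
      = betaBinomialCum α β n (j + 1) - (j + 1 - t) * betaBinomial α β n j := by
    rw [eL, betaBinomialCum_succ]; ring
  set u := betaBinomial α β (n + 1) j
  set v := betaBinomial α β (n + 1) (j + 1)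
  set p := betaBinomial α β n j
  have hDu : 0 ≤ D * u := by positivity
  have hDv : 0 ≤ D * v := by positivity
  obtain ⟨l, hl⟩ := Nat.exists_eq_add_of_le hjn
  have hln : (n : ℝ) = j + l := by rw [hl]; push_cast; ring
  have hl0 : (0 : ℝ) ≤ l := l.cast_nonneg
  have hj0 : (0 : ℝ) ≤ j := j.cast_nonneg
  have first : y ≤ j + 1 → betaBinomialCum α β n j - j / (n + 1) * u + (y - j) * u
      = linInterp (betaBinomialCum α β (n + 1)) y := by
    intro h
    rw [linInterp_eq _ hjy h, betaBinomialCum_succ, hS1]; ring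
  have second : j + 1 ≤ y → y ≤ j + 2 →
      betaBinomialCum α β n (j + 1) - (j + 1) / (n + 1) * v + (y - (j + 1)) * v
      = linInterp (betaBinomialCum α β (n + 1)) y := by
    intro h h'
    rw [linInterp_eq _ (j := j + 1) (by push_cast; exact h) (by push_cast; linarith),
      betaBinomialCum_succ _ _ _ (j + 1), hS2]
    push_cast; ring
  have third : j + 2 ≤ y → betaBinomialCum α β n (j + 1)
      ≤ linInterp (betaBinomialCum α β (n + 1)) y := by
    intro h
    have h2 := betaBinomialCum_succ α β (n + 1) (j + 1)
    have : betaBinomialCum α β n (j + 1) ≤ betaBinomialCum α β (n + 1) (j + 2) := by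
      rw [h2, hS2]
      push_cast
      have : ((j : ℝ) + 1) / (n + 1) ≤ 1 := by rw [div_le_one hN]; linarith
      nlinarith
    refine this.trans ?_
    rw [← linInterp_natCast (betaBinomialCum α β (n + 1)) (j + 2)]
    exact linInterp_mono hmono (Nat.cast_nonneg _) (by push_cast; exact h)
  have low : linInterp (betaBinomialCum α β n) t ≤ betaBinomialCum α β n (j + 1) := by
    rw [eL2]
    have : 0 ≤ (j + 1 - t) * p :=
      mul_nonneg (by linarith) (betaBinomial_nonneg hα hβ _ _)
    linarith
  rcases le_or_gt (j + 2 : ℝ) y with hy2 | hy2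
  · exact low.trans (third hy2)
  -- The gap to each affine piece, cleared of denominators: the shift contributes `D * u` or `D *
  -- v`, and the only possible loss is a multiple of `v - u`.
  have clear1 : (n + 1) * (betaBinomialCum α β n j - j / (n + 1) * u + (y - j) * u
      - (betaBinomialCum α β n j + (t - j) * p))
      = D * u - (t - j) * (j + 1) * (v - u) := by
    have : (n + 1) * ((j : ℝ) / (n + 1)) = j := by field_simp
    linear_combination (-u) * this + u * hy' - (t - j) * hp
  have clear2 : (n + 1) * (betaBinomialCum α β n (j + 1) - (j + 1) / (n + 1) * v
      + (y - (j + 1)) * v - (betaBinomialCum α β n (j + 1) - (j + 1 - t) * p))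
      = D * v - (j + 1 - t) * (n + 1 - j) * (v - u) := by
    have : (n + 1) * (((j : ℝ) + 1) / (n + 1)) = j + 1 := by field_simp
    linear_combination (-v) * this + v * hy' + (j + 1 - t) * hp
  have line1 : (t - j) * (j + 1) * (v - u) ≤ D * u →
      linInterp (betaBinomialCum α β n) t
        ≤ betaBinomialCum α β n j - j / (n + 1) * u + (y - j) * u := by
    intro h
    rw [eL, ← sub_nonneg]
    exact (mul_nonneg_iff_of_pos_left hN).1 (by rw [clear1]; linarith)
  have line2 : (j + 1 - t) * (n + 1 - j) * (v - u) ≤ D * v →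
      linInterp (betaBinomialCum α β n) t
        ≤ betaBinomialCum α β n (j + 1) - (j + 1) / (n + 1) * v + (y - (j + 1)) * v := by
    intro h
    rw [eL2, ← sub_nonneg]
    exact (mul_nonneg_iff_of_pos_left hN).1 (by rw [clear2]; linarith)
  have gap : betaBinomialCum α β n (j + 1) - (j + 1) / (n + 1) * v
      = betaBinomialCum α β n j - j / (n + 1) * u + u := by
    have h1 := betaBinomialCum_succ α β (n + 1) j
    rw [hS1, hS2] at h1
    push_cast at h1
    exact h1
  -- If `v ≤ u` neither piece loses anything, so the piece containing `y` can be used.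
  rcases le_or_gt v u with huv | huv
  · have n1 : (t - j) * (j + 1) * (v - u) ≤ 0 :=
      mul_nonpos_of_nonneg_of_nonpos (mul_nonneg (by linarith) (by linarith)) (by linarith)
    have n2 : (j + 1 - t) * (n + 1 - j) * (v - u) ≤ 0 :=
      mul_nonpos_of_nonneg_of_nonpos (mul_nonneg (by linarith) (by linarith)) (by linarith)
    rcases le_total y (j + 1) with hc | hc
    · exact (line1 (by linarith)).trans (first hc).le
    · exact (line2 (by linarith)).trans (second hc hy2.le).le
  -- If `u < v`, the piece is chosen by the unshifted image of `t`, which makes the loss small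
  -- enough for `betaBinomial_diff_le`. When the shift carries `y` past `j + 1` in the first case,
  -- convexity at that node keeps the interpolation above the extended first piece.
  · rcases le_total (t * (n + 2)) ((j + 1) * (n + 1)) with hc | hc
    · have hs : (t - j) * (n + 2) ≤ n + 1 - j := by linarith
      have n1 : (t - j) * (j + 1) * (v - u) ≤ D * u := by
        have : (n + 2) * ((t - j) * (j + 1) * (v - u)) ≤ (n + 2) * (D * u) := by
          calc (n + 2) * ((t - j) * (j + 1) * (v - u))
              = (t - j) * (n + 2) * ((j + 1) * (v - u)) := by ring
            _ ≤ (n + 1 - j) * ((j + 1) * (v - u)) :=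
                mul_le_mul_of_nonneg_right hs (mul_nonneg (by linarith) (by linarith))
            _ = (j + 1) * (n + 1 - j) * (v - u) := by ring
            _ ≤ (n + 2) * D * u := hd1
            _ = _ := by ring
        exact le_of_mul_le_mul_left this (by positivity)
      refine (line1 n1).trans ?_
      rcases le_total y (j + 1) with hc' | hc'
      · exact (first hc').le
      · rw [← second hc' hy2.le, gap]
        linarith [mul_nonneg (sub_nonneg.2 hc') (sub_nonneg.2 huv.le)]
    · have hs : (j + 1 - t) * (n + 2) ≤ j + 1 := by linarith
      have n2 : (j + 1 - t) * (n + 1 - j) * (v - u) ≤ D * v := by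
        have : (n + 2) * ((j + 1 - t) * (n + 1 - j) * (v - u)) ≤ (n + 2) * (D * v) := by
          calc (n + 2) * ((j + 1 - t) * (n + 1 - j) * (v - u))
              = (j + 1 - t) * (n + 2) * ((n + 1 - j) * (v - u)) := by ring
            _ ≤ (j + 1) * ((n + 1 - j) * (v - u)) :=
                mul_le_mul_of_nonneg_right hs (mul_nonneg (by linarith) (by linarith))
            _ = (j + 1) * (n + 1 - j) * (v - u) := by ring
            _ ≤ (n + 2) * D * v := hd2
            _ = _ := by ring
        exact le_of_mul_le_mul_left this (by positivity)
      refine (line2 n2).trans (second ?_ hy2.le).le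
      by_contra hcc
      linarith [mul_lt_mul_of_pos_right (not_le.1 hcc) hN]

/-- The arguments `(m + 1) * z - betaShift α β` are exactly the orbit of the affine map in the
one-step comparison, so that comparison iterates with no growth of the shift. -/
lemma linInterp_betaBinomialCum_le {α β : ℝ} (hα : 0 < α) (hβ : 0 < β) {n m : ℕ} (hnm : n ≤ m)
    {z : ℝ} (hz : 0 ≤ (n + 1) * z - betaShift α β) :
    0 ≤ (m + 1) * z - betaShift α β ∧
    linInterp (betaBinomialCum α β n) ((n + 1) * z - betaShift α β)
      ≤ linInterp (betaBinomialCum α β m) ((m + 1) * z - betaShift α β) := by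
  have hz0 : 0 ≤ z := by
    have := betaShift_nonneg hα hβ
    by_contra h
    nlinarith [not_le.1 h, n.cast_nonneg (α := ℝ)]
  induction m, hnm using Nat.le_induction with
  | base => exact ⟨hz, le_rfl⟩
  | succ m _ ih =>
    refine ⟨by push_cast; linarith [ih.1],
      ih.2.trans ((linInterp_betaBinomialCum_le_succ hα hβ m ih.1).trans_eq ?_)⟩
    congr 1
    push_cast
    field_simp
    ring

/-! ### Comparison with the beta distribution function, and quantiles. -/

lemma cdf_betaMeasure_one {α β : ℝ} (hα : 0 < α) (hβ : 0 < β) {x : ℝ} (hx : 1 ≤ x) :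
    cdf (betaMeasure α β) x = 1 := by
  have hprob := isProbabilityMeasureBeta hα hβ
  rw [cdf_eq_real, measureReal_def, prob_compl_eq_zero_iff measurableSet_Iic |>.1]
  · simp
  · refine measure_mono_null (t := (Set.Ioo 0 1)ᶜ) ?_ (ae_betaMeasure_mem_Ioo α β)
    exact fun y hy hy' => hy (hy'.2.le.trans hx)

/-- One-sided comparison of the beta-binomial and beta distribution functions. -/
lemma betaBinomialCum_le_cdf {α β : ℝ} (hα : 0 < α) (hβ : 0 < β) (n k : ℕ) :
    betaBinomialCum α β n k ≤ cdf (betaMeasure α β) ((k + betaShift α β + 1) / (n + 1)) := by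
  have hprob := isProbabilityMeasureBeta hα hβ
  have hD := betaShift_nonneg hα hβ
  set z : ℝ := (k + betaShift α β + 1) / (n + 1) with hz
  have hN : (0 : ℝ) < n + 1 := by positivity
  have hnz : (n + 1) * z = k + betaShift α β + 1 := by rw [hz]; field_simp
  rcases le_or_gt 1 z with h1 | h1
  · exact (betaBinomialCum_le_one hα hβ n k).trans (cdf_betaMeasure_one hα hβ h1).ge
  -- By right continuity it suffices to bound by the distribution function at any `y > z`. The ramp
  -- `f`, equal to one up to `z` and to zero from `y` on, is a continuous test function for the weak
  -- limit.
  have hright : Filter.Tendsto (cdf (betaMeasure α β)) (nhdsWithin z (Set.Ioi z))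
      (nhds (cdf (betaMeasure α β) z)) :=
    Filter.Tendsto.mono_left ((cdf (betaMeasure α β)).right_continuous z)
      (nhdsWithin_mono _ Set.Ioi_subset_Ici_self)
  refine ge_of_tendsto hright ?_
  filter_upwards [self_mem_nhdsWithin] with y hy
  have hy : z < y := hy
  let f : ℝ → ℝ := fun x => max 0 (min 1 ((y - x) / (y - z)))
  have hf : Continuous f := by fun_prop
  have hf0 : ∀ x, 0 ≤ f x := fun x => le_max_left _ _
  have hfz : ∀ x ≤ z, f x = 1 := by
    intro x hx
    have : 1 ≤ (y - x) / (y - z) := by rw [le_div_iff₀ (by linarith)]; linarith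
    simp [f, this]
  have hfi : ∫ b, f b ∂betaMeasure α β ≤ cdf (betaMeasure α β) y := by
    rw [cdf_eq_real, ← integral_indicator_one measurableSet_Iic]
    refine integral_mono_of_nonneg (Filter.Eventually.of_forall hf0)
      ((integrable_const 1).indicator measurableSet_Iic) (Filter.Eventually.of_forall fun x => ?_)
    rcases le_or_gt x y with hx | hx
    · simp [Set.indicator, hx, f]
    · have : (y - x) / (y - z) ≤ 0 := div_nonpos_of_nonpos_of_nonneg (by linarith) (by linarith)
      simp [Set.indicator, f, hx.not_ge, this]
  refine le_trans (ge_of_tendsto (tendsto_sum_betaBinomial hα hβ hf) ?_) hfi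
  filter_upwards [Filter.eventually_ge_atTop (n + 1)] with m hm
  have hm' : (n + 1 : ℝ) ≤ m := by exact_mod_cast hm
  have hm0 : (0 : ℝ) < m := hN.trans_le hm'
  -- The extra `1` in `z` separates it from `z'` by `1 / (n + 1)`. For `m ≥ n + 1` this leaves room
  -- for every `j ≤ T` to satisfy `j / m ≤ z`, where the ramp equals one.
  set z' : ℝ := (k + betaShift α β) / (n + 1) with hz'
  have hnz' : (n + 1) * z' = k + betaShift α β := by rw [hz']; field_simp
  have hzz' : (n + 1) * (z - z') = 1 := by linarith
  obtain ⟨hT, hchain⟩ := linInterp_betaBinomialCum_le hα hβ (Nat.le_of_succ_le hm) (z := z')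
    (by rw [hnz']; linarith [k.cast_nonneg (α := ℝ)])
  rw [hnz', add_sub_cancel_right, linInterp_natCast] at hchain
  set T := (m + 1) * z' - betaShift α β with hTdef
  refine (hchain.trans (linInterp_le_floor_succ (betaBinomialCum_mono hα hβ m))).trans ?_
  have hz'z : 0 < z - z' := by
    by_contra h
    nlinarith [not_lt.1 h]
  calc betaBinomialCum α β m (⌊T⌋₊ + 1)
      = ∑ j ∈ Finset.range (⌊T⌋₊ + 1), f (j / m) * betaBinomial α β m j := by
        refine Finset.sum_congr rfl fun j hj => ?_
        have h1 : (j : ℝ) ≤ T :=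
          (Nat.cast_le.2 (Nat.lt_succ_iff.1 (Finset.mem_range.1 hj))).trans (Nat.floor_le hT)
        rw [hfz, one_mul]
        rw [div_le_iff₀ hm0]
        have : (n + 1) * (z - z') ≤ m * (z - z') := mul_le_mul_of_nonneg_right hm' hz'z.le
        linarith
    _ ≤ ∑ j ∈ Finset.range (max (⌊T⌋₊ + 1) (m + 1)), f (j / m) * betaBinomial α β m j :=
        Finset.sum_le_sum_of_subset_of_nonneg (Finset.range_mono (le_max_left _ _))
          fun j _ _ => mul_nonneg (hf0 _) (betaBinomial_nonneg hα hβ _ _)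
    _ = _ := by
        refine (Finset.sum_subset (Finset.range_mono (le_max_right _ _)) fun j _ hj => ?_).symm
        rw [betaBinomial_of_lt _ _ (by simpa [Nat.lt_succ_iff] using hj), mul_zero]

instance nullSingletonClass_betaMeasure (α β : ℝ) : NullSingletonClass (betaMeasure α β) where
  measure_singleton x := (withDensity_absolutelyContinuous volume _) (by simp)

lemma cdf_betaMeasure_sub {α β : ℝ} (hα : 0 < α) (hβ : 0 < β) (s t : ℝ) :
    betaMeasure α β (Set.Ioc s t)
      = ENNReal.ofReal (cdf (betaMeasure α β) t - cdf (betaMeasure α β) s) := by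
  have hprob := isProbabilityMeasureBeta hα hβ
  rw [← StieltjesFunction.measure_Ioc, measure_cdf]

lemma continuous_cdf_betaMeasure {α β : ℝ} (hα : 0 < α) (hβ : 0 < β) :
    Continuous (cdf (betaMeasure α β)) := by
  have hprob := isProbabilityMeasureBeta hα hβ
  rw [continuous_iff_continuousAt]
  intro x
  have hmono := (cdf (betaMeasure α β)).mono
  rw [hmono.continuousAt_iff_leftLim_eq_rightLim, StieltjesFunction.rightLim_eq]
  have h := StieltjesFunction.measure_singleton (cdf (betaMeasure α β)) x
  rw [measure_cdf, measure_singleton, eq_comm, ENNReal.ofReal_eq_zero] at h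
  exact le_antisymm (hmono.leftLim_le le_rfl) (by linarith)

lemma cdf_betaMeasure_zero {α β : ℝ} (hα : 0 < α) (hβ : 0 < β) :
    cdf (betaMeasure α β) 0 = 0 := by
  have hprob := isProbabilityMeasureBeta hα hβ
  rw [cdf_eq_real, measureReal_def, measure_mono_null (t := (Set.Ioo 0 1)ᶜ) _
    (ae_betaMeasure_mem_Ioo α β)]
  · simp
  · exact fun x hx hx' => hx'.1.not_ge hx

lemma cdf_betaMeasure_strictMonoOn {α β : ℝ} (hα : 0 < α) (hβ : 0 < β) :
    StrictMonoOn (cdf (betaMeasure α β)) (Set.Icc 0 1) := by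
  have hprob := isProbabilityMeasureBeta hα hβ
  intro s hs t ht hst
  by_contra hc
  have h0 : betaMeasure α β (Set.Ioc s t) = 0 := by
    rw [cdf_betaMeasure_sub hα hβ]
    exact ENNReal.ofReal_of_nonpos (by linarith)
  rw [betaMeasure, withDensity_apply_eq_zero (by unfold betaPDF; fun_prop)] at h0
  have h1 : Set.Ioo s t ⊆ {x | betaPDF α β x ≠ 0} ∩ Set.Ioc s t := fun x hx =>
    ⟨(ENNReal.ofReal_pos.2 (betaPDFReal_pos (hs.1.trans_lt hx.1) (hx.2.trans_le ht.2) hα hβ)).ne',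
      Set.Ioo_subset_Ioc_self hx⟩
  have h2 := measure_mono_null h1 h0
  rw [Real.volume_Ioo, ENNReal.ofReal_eq_zero] at h2
  linarith

lemma map_one_sub_betaMeasure (α β : ℝ) :
    (betaMeasure α β).map (fun b => 1 - b) = betaMeasure β α := by
  ext s hs
  have hm : Measurable fun b : ℝ => 1 - b := by fun_prop
  rw [Measure.map_apply hm hs, betaMeasure, betaMeasure,
    withDensity_apply _ (hm hs), withDensity_apply _ hs, ← lintegral_indicator (hm hs),
    ← lintegral_indicator hs, ← lintegral_sub_left_eq_self _ (1 : ℝ)]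
  refine lintegral_congr fun b => ?_
  by_cases hb : b ∈ s
  · rw [Set.indicator_of_mem (by simpa using hb), Set.indicator_of_mem hb, betaPDF, betaPDF,
      betaPDFReal, betaPDFReal, beta, beta, mul_comm (Real.Gamma α), add_comm α]
    simp only [sub_pos, sub_lt_self_iff, sub_sub_cancel, and_comm (a := b < 1)]
    simp only [mul_right_comm]
  · rw [Set.indicator_of_notMem (by simpa using hb), Set.indicator_of_notMem hb]

lemma cdf_betaMeasure_one_sub {α β : ℝ} (hα : 0 < α) (hβ : 0 < β) (x : ℝ) :
    cdf (betaMeasure β α) (1 - x) = 1 - cdf (betaMeasure α β) x := by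
  have := isProbabilityMeasureBeta hα hβ
  have := isProbabilityMeasureBeta hβ hα
  have h : (fun b : ℝ => 1 - b) ⁻¹' Set.Iic (1 - x) = Set.Ici x := by ext; simp
  rw [cdf_eq_real, cdf_eq_real, ← map_one_sub_betaMeasure, map_measureReal_apply (by fun_prop)
    measurableSet_Iic, h, ← probReal_compl_eq_one_sub measurableSet_Iic, Set.compl_Iic]
  exact measureReal_congr Ioi_ae_eq_Ici.symm

/-- The unit interval splits into consecutive intervals which carry the beta-binomial masses under
the beta distribution, and whose endpoints are close to being equally spaced. -/
lemma exists_betaMeasure_partition {α β : ℝ} (hα : 0 < α) (hβ : 0 < β) :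
    ∃ D : ℝ, 0 ≤ D ∧ ∀ n : ℕ, ∃ t : ℕ → ℝ, Monotone t ∧ t 0 = 0 ∧ t (n + 1) = 1 ∧
      (∀ k, betaMeasure α β (Set.Ioc (t k) (t (k + 1))) = ENNReal.ofReal (betaBinomial α β n k)) ∧
      ∀ k ≤ n + 1, |(n + 1) * t k - k| ≤ D := by
  have hprob := isProbabilityMeasureBeta hα hβ
  have hD := betaShift_nonneg hα hβ
  have hF0 := cdf_betaMeasure_zero hα hβ
  have hF1 := cdf_betaMeasure_one hα hβ le_rfl
  have hmono := cdf_betaMeasure_strictMonoOn hα hβ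
  refine ⟨betaShift α β + 1, by linarith, fun n => ?_⟩
  have hN : (0 : ℝ) < n + 1 := by positivity
  -- The endpoints are the beta quantiles of the beta-binomial cumulative probabilities.
  have hex : ∀ k, ∃ t ∈ Set.Icc (0 : ℝ) 1, cdf (betaMeasure α β) t = betaBinomialCum α β n k := by
    intro k
    refine intermediate_value_Icc zero_le_one (continuous_cdf_betaMeasure hα hβ).continuousOn ?_
    rw [hF0, hF1]
    exact ⟨betaBinomialCum_nonneg hα hβ n k, betaBinomialCum_le_one hα hβ n k⟩
  choose t ht htF using hex
  have htm : Monotone t := fun k l hkl => by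
    rw [← hmono.le_iff_le (ht k) (ht l), htF, htF]
    exact betaBinomialCum_mono hα hβ n hkl
  have upper : ∀ k, (n + 1) * t k ≤ k + betaShift α β + 1 := by
    intro k
    by_contra! hc
    have h1 := betaBinomialCum_le_cdf hα hβ n k
    have hz : (k + betaShift α β + 1) / (n + 1) < t k := by rw [div_lt_iff₀ hN]; linarith
    have := hmono ⟨by positivity, hz.le.trans (ht k).2⟩ (ht k) hz
    rw [htF] at this
    linarith
  -- The one-sided comparison with `α` and `β` exchanged, applied to the number of failures.
  have lower : ∀ k ≤ n + 1, k - betaShift α β - 1 ≤ (n + 1) * t k := by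
    intro k hk
    by_contra! hc
    have h1 := betaBinomialCum_le_cdf hβ hα n (n + 1 - k)
    rw [← betaBinomialCum_symm hα hβ hk, ← htF, betaShift_comm, Nat.cast_sub hk] at h1
    have hz : (((n + 1 : ℕ) : ℝ) - k + betaShift α β + 1) / (n + 1)
        = 1 - (k - betaShift α β - 1) / (n + 1) := by push_cast; field_simp; ring
    rw [hz, cdf_betaMeasure_one_sub hα hβ] at h1
    have hk' : (k : ℝ) ≤ n + 1 := by exact_mod_cast hk
    have hz : t k < (k - betaShift α β - 1) / (n + 1) := by rw [lt_div_iff₀ hN]; linarith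
    have := hmono (ht k) ⟨(ht k).1.trans hz.le, by rw [div_le_one hN]; linarith⟩ hz
    linarith
  refine ⟨t, htm, hmono.injOn (ht 0) (by simp) ?_, hmono.injOn (ht _) (by simp) ?_, ?_, ?_⟩
  · rw [htF, hF0, betaBinomialCum_zero]
  · rw [htF, hF1, betaBinomialCum_of_lt hα hβ (by omega)]
  · intro k
    rw [cdf_betaMeasure_sub hα hβ, htF, htF, betaBinomialCum_succ]
    simp
  · intro k hk
    rw [abs_le]
    constructor
    · linarith [lower k hk]
    · linarith [upper k]

/-! ### The Dirichlet distribution and stick-breaking. -/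

lemma simplexPoint_castSucc {m : ℕ} (y : Fin m → ℝ) (i : Fin m) :
    simplexPoint (q := m + 1) y i.castSucc = y i := by
  simp [simplexPoint]

lemma simplexPoint_last {m : ℕ} (y : Fin m → ℝ) :
    simplexPoint (q := m + 1) y (Fin.last m) = 1 - ∑ j, y j := by
  simp [simplexPoint]

lemma sum_simplexPoint {m : ℕ} (y : Fin m → ℝ) : ∑ i, simplexPoint (q := m + 1) y i = 1 := by
  rw [Fin.sum_univ_castSucc, simplexPoint_last]
  simp [simplexPoint_castSucc]

lemma measurable_simplexPoint {m : ℕ} :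
    Measurable (simplexPoint (q := m + 1) : (Fin m → ℝ) → Fin (m + 1) → ℝ) := by
  rw [measurable_pi_iff]
  intro i
  induction i using Fin.lastCases with
  | last =>
    change Measurable fun y : Fin m → ℝ => simplexPoint (q := m + 1) y (Fin.last m)
    simp_rw [simplexPoint_last]; fun_prop
  | cast i =>
    change Measurable fun y : Fin m → ℝ => simplexPoint (q := m + 1) y i.castSucc
    simp_rw [simplexPoint_castSucc]; fun_prop

lemma measurable_dirichletPDF {m : ℕ} (α : Fin (m + 1) → ℝ) :
    Measurable (dirichletPDF (q := m + 1) α : (Fin m → ℝ) → ℝ≥0∞) := by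
  have h : ∀ i, Measurable fun y : Fin m → ℝ => simplexPoint (q := m + 1) y i :=
    fun i => (measurable_pi_iff.1 measurable_simplexPoint) i
  refine ENNReal.measurable_ofReal.comp (Measurable.ite ?_ ?_ measurable_const)
  · rw [Set.ofPred_forall]
    exact MeasurableSet.iInter fun i => measurableSet_lt measurable_const (h i)
  · exact (Finset.measurable_prod _ fun i _ => (h i).pow_const _).const_mul _

lemma lintegral_dirichletMeasure {m : ℕ} (α : Fin (m + 1) → ℝ) {f : (Fin (m + 1) → ℝ) → ℝ≥0∞}
    (hf : Measurable f) :
    ∫⁻ w, f w ∂dirichletMeasure α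
      = ∫⁻ y : Fin m → ℝ, dirichletPDF (q := m + 1) α y * f (simplexPoint (q := m + 1) y) := by
  rw [dirichletMeasure, lintegral_map hf measurable_simplexPoint]
  exact lintegral_withDensity_eq_lintegral_mul _ (measurable_dirichletPDF α)
    (hf.comp measurable_simplexPoint)

lemma ae_dirichletMeasure {m : ℕ} (α : Fin (m + 1) → ℝ) :
    ∀ᵐ w ∂dirichletMeasure α, (∀ i, 0 < w i) ∧ ∑ i, w i = 1 := by
  rw [dirichletMeasure, ae_map_iff measurable_simplexPoint.aemeasurable,
    ae_withDensity_iff (measurable_dirichletPDF α)]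
  · refine Filter.Eventually.of_forall fun y hy => ⟨?_, sum_simplexPoint y⟩
    by_contra h
    exact hy (by simp [dirichletPDF, h])
  · rw [Set.ofPred_and, Set.ofPred_forall]
    exact (MeasurableSet.iInter fun i => measurableSet_lt measurable_const (by fun_prop)).inter
      (measurableSet_eq_fun (by fun_prop) (by fun_prop))

lemma simplexPoint_cons {m : ℕ} (b : ℝ) (z : Fin m → ℝ) :
    simplexPoint (q := m + 2) (Fin.cons b fun i => (1 - b) * z i : Fin (m + 1) → ℝ)
      = Fin.cons b fun i => (1 - b) * simplexPoint (q := m + 1) z i := by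
  ext i
  induction i using Fin.lastCases with
  | last =>
    rw [simplexPoint_last, ← Fin.succ_last, Fin.cons_succ, simplexPoint_last, Fin.sum_univ_succ,
      Fin.cons_zero]
    simp only [Fin.cons_succ, ← Finset.mul_sum]
    ring
  | cast i =>
    rw [simplexPoint_castSucc]
    induction i using Fin.cases with
    | zero => rfl
    | succ i => rw [← Fin.succ_castSucc, Fin.cons_succ, Fin.cons_succ, simplexPoint_castSucc]

/-- The factor `(1 - b) ^ m` is the Jacobian of scaling the `m` free coordinates by `1 - b`. It
supplies the powers of `1 - b` missing from the beta density, and the Gamma factors telescope. -/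
lemma dirichletPDF_cons {m : ℕ} {α : Fin (m + 2) → ℝ} (hα : ∀ i, 0 < α i) {b : ℝ}
    (hb0 : 0 < b) (hb1 : b < 1) (z : Fin m → ℝ) :
    ENNReal.ofReal ((1 - b) ^ m) *
        dirichletPDF (q := m + 2) α (Fin.cons b fun i => (1 - b) * z i : Fin (m + 1) → ℝ)
      = betaPDF (α 0) (∑ i : Fin (m + 1), α i.succ) b
        * dirichletPDF (q := m + 1) (fun i => α i.succ) z := by
  have hb : 0 < 1 - b := by linarith
  have hA : 0 < ∑ i : Fin (m + 1), α i.succ := Finset.sum_pos (fun i _ => hα _) (by simp)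
  rw [dirichletPDF, dirichletPDF, simplexPoint_cons, betaPDF_of_pos_lt_one hb0 hb1,
    ← ENNReal.ofReal_mul (by positivity), ← ENNReal.ofReal_mul (by
      have := beta_pos (hα 0) hA
      positivity)]
  congr 1
  set s := simplexPoint (q := m + 1) z
  have hcond : (∀ i : Fin (m + 2), 0 < (Fin.cons b fun i => (1 - b) * s i : Fin (m + 2) → ℝ) i)
      ↔ ∀ i, 0 < s i := by
    rw [Fin.forall_fin_succ]
    simp [hb0, hb]
  by_cases hs : ∀ i, 0 < s i
  · rw [if_pos (hcond.2 hs), if_pos hs, Fin.prod_univ_succ fun i => Real.Gamma (α i),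
      Fin.prod_univ_succ fun i : Fin (m + 2) =>
        (Fin.cons b fun i => (1 - b) * s i : Fin (m + 2) → ℝ) i ^ (α i - 1), Fin.sum_univ_succ]
    simp only [Fin.cons_zero, Fin.cons_succ]
    have h1 : ∏ i : Fin (m + 1), ((1 - b) * s i) ^ (α i.succ - 1)
        = (1 - b) ^ ((∑ i : Fin (m + 1), α i.succ) - 1 - m)
          * ∏ i : Fin (m + 1), s i ^ (α i.succ - 1) := by
      rw [show (∑ i : Fin (m + 1), α i.succ) - 1 - m = ∑ i : Fin (m + 1), (α i.succ - 1) by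
        simp; ring, Real.rpow_sum_of_pos hb, ← Finset.prod_mul_distrib]
      exact Finset.prod_congr rfl fun i _ => Real.mul_rpow hb.le (hs i).le
    have h2 : (1 - b) ^ ((∑ i : Fin (m + 1), α i.succ) - 1)
        = (1 - b) ^ m * (1 - b) ^ ((∑ i : Fin (m + 1), α i.succ) - 1 - m) := by
      rw [← Real.rpow_natCast, ← Real.rpow_add hb]; congr 1; ring
    rw [h1, h2, beta]
    have g1 := Real.Gamma_pos_of_pos (hα 0)
    have g2 := Real.Gamma_pos_of_pos hA
    have g3 : 0 < ∏ i : Fin (m + 1), Real.Gamma (α i.succ) :=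
      Finset.prod_pos fun i _ => Real.Gamma_pos_of_pos (hα _)
    have g4 := Real.Gamma_pos_of_pos (add_pos (hα 0) hA)
    field_simp
  · rw [if_neg (hcond.not.2 hs), if_neg hs]
    simp

lemma dirichletPDF_cons_eq_zero {m : ℕ} (α : Fin (m + 2) → ℝ) {b : ℝ}
    (hb : ¬ (0 < b ∧ b < 1)) (y : Fin m → ℝ) :
    dirichletPDF (q := m + 2) α (Fin.cons b y : Fin (m + 1) → ℝ) = 0 := by
  rw [dirichletPDF, if_neg, ENNReal.ofReal_zero]
  intro h
  have h0 : simplexPoint (q := m + 2) (Fin.cons b y : Fin (m + 1) → ℝ) 0 = b :=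
    simplexPoint_castSucc (m := m + 1) _ 0
  refine hb ⟨h0 ▸ h 0, ?_⟩
  have h1 := sum_simplexPoint (Fin.cons b y : Fin (m + 1) → ℝ)
  rw [Fin.sum_univ_succ, h0] at h1
  have h2 : 0 < ∑ i : Fin (m + 1), simplexPoint (q := m + 2) (Fin.cons b y : Fin (m + 1) → ℝ) i.succ :=
    Finset.sum_pos (fun i _ => h _) (by simp)
  linarith

lemma lintegral_eq_lintegral_smul {m : ℕ} {r : ℝ} (hr : 0 < r) {f : (Fin m → ℝ) → ℝ≥0∞}
    (hf : Measurable f) :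
    ∫⁻ y, f y = ∫⁻ z : Fin m → ℝ, ENNReal.ofReal (r ^ m) * f (fun i => r * z i) := by
  have h := Measure.map_addHaar_smul (volume : Measure (Fin m → ℝ)) hr.ne'
  rw [lintegral_const_mul _ (by fun_prop)]
  have h2 : ∫⁻ z : Fin m → ℝ, f (fun i => r * z i) = ∫⁻ y, f y ∂(Measure.map (r • ·) volume) := by
    rw [lintegral_map hf (by fun_prop)]; rfl
  rw [h2, h, lintegral_smul_measure, smul_eq_mul, ← mul_assoc, ← ENNReal.ofReal_mul (by positivity)]
  have : r ^ m * |(r ^ Module.finrank ℝ (Fin m → ℝ))⁻¹| = 1 := by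
    rw [Module.finrank_fin_fun, abs_of_pos (by positivity)]
    exact mul_inv_cancel₀ (by positivity)
  rw [this, ENNReal.ofReal_one, one_mul]

/-- Prepend `b` to the vector `(1 - b) w`. -/
def stickBreak {m : ℕ} (b : ℝ) (w : Fin m → ℝ) : Fin (m + 1) → ℝ :=
  Fin.cons b fun i => (1 - b) * w i

lemma measurable_stickBreak {m : ℕ} :
    Measurable fun z : ℝ × (Fin m → ℝ) => stickBreak z.1 z.2 := by
  rw [measurable_pi_iff]
  intro i
  induction i using Fin.cases with
  | zero => simp only [stickBreak, Fin.cons_zero]; fun_prop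
  | succ i => simp only [stickBreak, Fin.cons_succ]; fun_prop

lemma sFinite_dirichletMeasure {m : ℕ} (α : Fin (m + 1) → ℝ) :
    SFinite (dirichletMeasure α) := by
  unfold dirichletMeasure; infer_instance

/-- The stick-breaking representation of the Dirichlet distribution. -/
lemma dirichletMeasure_eq_map_stickBreak {m : ℕ} {α : Fin (m + 2) → ℝ} (hα : ∀ i, 0 < α i) :
    dirichletMeasure α
      = ((betaMeasure (α 0) (∑ i : Fin (m + 1), α i.succ)).prod
          (dirichletMeasure fun i : Fin (m + 1) => α i.succ)).map
          fun z => stickBreak z.1 z.2 := by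
  have := sFinite_dirichletMeasure fun i : Fin (m + 1) => α i.succ
  refine Measure.ext_of_lintegral _ fun f hf => ?_
  have hG : Measurable fun y : Fin (m + 1) → ℝ =>
      dirichletPDF (q := m + 2) α y * f (simplexPoint (q := m + 2) y) :=
    (measurable_dirichletPDF α).mul (hf.comp measurable_simplexPoint)
  have hfs : Measurable fun z : ℝ × (Fin (m + 1) → ℝ) => f (stickBreak z.1 z.2) :=
    hf.comp measurable_stickBreak
  rw [lintegral_map hf measurable_stickBreak, lintegral_prod _ hfs.aemeasurable,
    lintegral_betaMeasure _ _ hfs.lintegral_prod_right',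
    lintegral_dirichletMeasure α hf,
    ← ((volume_preserving_piFinSuccAbove (fun _ : Fin (m + 1) => ℝ) 0).symm).lintegral_comp
      hG]
  have hcons : Measurable fun p : ℝ × (Fin m → ℝ) => (Fin.cons p.1 p.2 : Fin (m + 1) → ℝ) := by
    rw [measurable_pi_iff]
    intro i
    induction i using Fin.cases with
    | zero => simp only [Fin.cons_zero]; fun_prop
    | succ i => simp only [Fin.cons_succ]; fun_prop
  have he : ∀ p : ℝ × (Fin m → ℝ),
      (MeasurableEquiv.piFinSuccAbove (fun _ : Fin (m + 1) => ℝ) 0).symm p = Fin.cons p.1 p.2 := by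
    intro p
    simp [MeasurableEquiv.piFinSuccAbove, Fin.insertNthEquiv]
  simp_rw [he]
  have hGc : Measurable fun p : ℝ × (Fin m → ℝ) =>
      dirichletPDF (q := m + 2) α (Fin.cons p.1 p.2 : Fin (m + 1) → ℝ)
        * f (simplexPoint (q := m + 2) (Fin.cons p.1 p.2 : Fin (m + 1) → ℝ)) := hG.comp hcons
  rw [Measure.volume_eq_prod, lintegral_prod _ hGc.aemeasurable]
  refine lintegral_congr fun b => ?_
  simp only
  by_cases hb : 0 < b ∧ b < 1
  · have hGb : Measurable fun y : Fin m → ℝ =>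
        dirichletPDF (q := m + 2) α (Fin.cons b y : Fin (m + 1) → ℝ)
          * f (simplexPoint (q := m + 2) (Fin.cons b y : Fin (m + 1) → ℝ)) :=
      hG.comp (hcons.comp measurable_prodMk_left)
    refine (lintegral_eq_lintegral_smul (r := 1 - b) (by linarith [hb.2]) hGb).trans ?_
    have hfb : Measurable fun w : Fin (m + 1) → ℝ => f (stickBreak b w) :=
      hf.comp (measurable_stickBreak.comp measurable_prodMk_left)
    have hfb' : Measurable fun z : Fin m → ℝ =>
        dirichletPDF (q := m + 1) (fun i => α i.succ) z
          * f (stickBreak b (simplexPoint (q := m + 1) z)) :=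
      (measurable_dirichletPDF _).mul (hfb.comp measurable_simplexPoint)
    rw [lintegral_dirichletMeasure _ hfb, ← lintegral_const_mul _ hfb']
    refine lintegral_congr fun z => ?_
    rw [← mul_assoc, dirichletPDF_cons hα hb.1 hb.2, simplexPoint_cons, ← mul_assoc]
    rfl
  · have hz : betaPDF (α 0) (∑ i : Fin (m + 1), α i.succ) b = 0 := by simp [betaPDF_eq, hb]
    rw [hz, zero_mul]
    refine (lintegral_congr fun y => ?_).trans lintegral_zero
    rw [dirichletPDF_cons_eq_zero α hb, zero_mul]

lemma dirichletMeasure_one {α : Fin 1 → ℝ} (hα : 0 < α 0) :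
    dirichletMeasure α = Measure.dirac fun _ => 1 := by
  refine Measure.ext_of_lintegral _ fun f hf => ?_
  rw [lintegral_dirichletMeasure α hf, lintegral_dirac' _ hf]
  have h1 : simplexPoint (q := 0 + 1) (default : Fin 0 → ℝ) = fun _ => 1 := by
    ext i; simp [simplexPoint]
  have h2 : dirichletPDF (q := 0 + 1) α (default : Fin 0 → ℝ) = 1 := by
    have := (Real.Gamma_pos_of_pos hα).ne'
    rw [dirichletPDF, h1]
    simp [this]
  rw [volume_pi, Measure.pi_of_empty _ default, lintegral_dirac, h1, h2, one_mul]

lemma isProbabilityMeasure_dirichletMeasure {m : ℕ} {α : Fin (m + 1) → ℝ} (hα : ∀ i, 0 < α i) :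
    IsProbabilityMeasure (dirichletMeasure α) := by
  induction m with
  | zero => rw [dirichletMeasure_one (hα 0)]; infer_instance
  | succ m ih =>
    have := ih fun i => hα i.succ
    have := isProbabilityMeasureBeta (hα 0)
      (Finset.sum_pos (fun i _ => hα _) (by simp) : 0 < ∑ i : Fin (m + 1), α i.succ)
    rw [dirichletMeasure_eq_map_stickBreak hα]
    exact Measure.isProbabilityMeasure_map measurable_stickBreak.aemeasurable

/-! ### Coupling the counts with a Dirichlet vector. -/

/-- The probability that `∑ kᵢ` draws from a Pólya urn with weights `α` yield the counts `k`. -/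
noncomputable def urnPmf {q : ℕ} (α : Fin q → ℝ) (k : Fin q → ℕ) : ℝ :=
  (∏ i, risingWeight (α i) (k i)) / risingWeight (∑ i, α i) (∑ i, k i)

/-- The discrete counterpart of stick-breaking: the first count is beta-binomial, and the other
counts follow the urn law of the remaining colours. -/
lemma urnPmf_eq_mul {m : ℕ} {α : Fin (m + 2) → ℝ} (hα : ∀ i, 0 < α i) (k : Fin (m + 2) → ℕ) :
    urnPmf α k = betaBinomial (α 0) (∑ i : Fin (m + 1), α i.succ) (∑ i, k i) (k 0)
      * urnPmf (fun i : Fin (m + 1) => α i.succ) (fun i => k i.succ) := by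
  have hA : 0 < ∑ i : Fin (m + 1), α i.succ := Finset.sum_pos (fun i _ => hα _) (by simp)
  have := (risingWeight_pos hA (∑ i : Fin (m + 1), k i.succ)).ne'
  rw [urnPmf, urnPmf, Fin.prod_univ_succ, Fin.sum_univ_succ α, Fin.sum_univ_succ k, betaBinomial_add]
  field_simp

lemma iUnion_Ioc_ae_univ {α β : ℝ} {n : ℕ} {t : ℕ → ℝ} (h0 : t 0 = 0)
    (h1 : t (n + 1) = 1) : ∀ᵐ b ∂betaMeasure α β, b ∈ ⋃ k, Set.Ioc (t k) (t (k + 1)) := by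
  filter_upwards [ae_betaMeasure_mem_Ioo α β] with b hb
  have hex : ∃ k, b ≤ t k := ⟨n + 1, h1 ▸ hb.2.le⟩
  classical
  have hf := Nat.find_spec hex
  obtain ⟨k, hk⟩ : ∃ k, Nat.find hex = k + 1 := by
    refine Nat.exists_eq_succ_of_ne_zero fun h => ?_
    rw [h, h0] at hf
    exact hf.not_gt hb.1
  refine Set.mem_iUnion.2 ⟨k, ?_, hk ▸ hf⟩
  exact not_le.1 (Nat.find_min hex (by omega))

/-- Prepend a count and break a stick. -/
def consCouple {m : ℕ} (k : ℕ) (z : ℝ × ((Fin m → ℕ) × (Fin m → ℝ))) :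
    (Fin (m + 1) → ℕ) × (Fin (m + 1) → ℝ) :=
  (Fin.cons k z.2.1, stickBreak z.1 z.2.2)

lemma measurable_consCouple {m k : ℕ} : Measurable (consCouple (m := m) k) := by
  refine Measurable.prodMk ?_ (measurable_stickBreak.comp (by fun_prop :
    Measurable fun z : ℝ × ((Fin m → ℕ) × (Fin m → ℝ)) => (z.1, z.2.2)))
  rw [measurable_pi_iff]
  intro i
  induction i using Fin.cases with
  | zero => simp only [Fin.cons_zero]; fun_prop
  | succ i => simp only [Fin.cons_succ]; fun_prop

lemma measurable_sum_abs_natCast_sub {m : ℕ} (c : ℝ) :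
    Measurable fun z : (Fin m → ℕ) × (Fin m → ℝ) => ∑ i, |(z.1 i : ℝ) - c * z.2 i| := by
  refine Finset.measurable_sum _ fun i _ => ?_
  have h : Measurable fun z : (Fin m → ℕ) × (Fin m → ℝ) => (z.1 i : ℝ) :=
    (measurable_from_nat (f := fun n : ℕ => (n : ℝ))).comp (by fun_prop)
  exact continuous_abs.measurable.comp (h.sub (by fun_prop))

/-- The error `D` enters twice: once in the first coordinate, and once in replacing `n - k` by `n *
(1 - b)` in the others, where the weights `w i` sum to one. -/
lemma sum_abs_stickBreak_le {m : ℕ} {n k : ℕ} (hk : k ≤ n) {b C D : ℝ} {k' : Fin m → ℕ}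
    {w : Fin m → ℝ} (hw : ∀ i, 0 < w i) (hw1 : ∑ i, w i = 1) (hb : |(k : ℝ) - n * b| ≤ D)
    (h : ∑ i, |(k' i : ℝ) - (n - k : ℕ) * w i| ≤ C) :
    ∑ i, |((Fin.cons k k' : Fin (m + 1) → ℕ) i : ℝ) - n * stickBreak b w i| ≤ C + 2 * D := by
  rw [Fin.sum_univ_succ]
  simp only [stickBreak, Fin.cons_zero, Fin.cons_succ]
  have h1 : ∀ i, |(k' i : ℝ) - n * ((1 - b) * w i)|
      ≤ |(k' i : ℝ) - (n - k : ℕ) * w i| + D * w i := by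
    intro i
    rw [show (k' i : ℝ) - n * ((1 - b) * w i)
      = ((k' i : ℝ) - (n - k : ℕ) * w i) + (-(k - n * b)) * w i by
        rw [Nat.cast_sub hk]; ring]
    refine (abs_add_le _ _).trans (add_le_add_right ?_ _)
    rw [abs_mul, abs_of_pos (hw i), abs_neg]
    exact mul_le_mul_of_nonneg_right hb (hw i).le
  have h2 := Finset.sum_le_sum fun i (_ : i ∈ Finset.univ) => h1 i
  rw [Finset.sum_add_distrib, ← Finset.mul_sum, hw1] at h2
  linarith

/-- The counts in a Pólya urn can be coupled with a Dirichlet vector with bounded error. -/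
theorem exists_urn_coupling {m : ℕ} {α : Fin (m + 1) → ℝ} (hα : ∀ i, 0 < α i) :
    ∃ C : ℝ, ∀ n : ℕ, ∃ π : Measure ((Fin (m + 1) → ℕ) × (Fin (m + 1) → ℝ)),
      π.map Prod.snd = dirichletMeasure α ∧
      (∀ k, π {z | z.1 = k} = if ∑ i, k i = n then ENNReal.ofReal (urnPmf α k) else 0) ∧
      ∀ᵐ z ∂π, ∑ i, |(z.1 i : ℝ) - n * z.2 i| ≤ C := by
  induction m with
  | zero =>
    refine ⟨0, fun n => ⟨Measure.dirac (fun _ => n, fun _ => 1), ?_, fun k => ?_, ?_⟩⟩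
    · rw [Measure.map_dirac' measurable_snd, dirichletMeasure_one (hα 0)]
    · have hms : MeasurableSet {z : (Fin (0 + 1) → ℕ) × (Fin (0 + 1) → ℝ) | z.1 = k} :=
        measurable_fst (measurableSet_singleton k)
      rw [Measure.dirac_apply' _ hms]
      have hk : (fun _ : Fin (0 + 1) => n) = k ↔ ∑ i, k i = n := by
        simp [funext_iff, eq_comm]
      by_cases h : ∑ i, k i = n
      · rw [if_pos h, Set.indicator_of_mem (by exact hk.2 h), urnPmf]
        simp [(risingWeight_pos (hα 0) (k 0)).ne']
      · rw [if_neg h, Set.indicator_of_notMem (by exact fun h' => h (hk.1 h'))]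
    · rw [ae_dirac_iff (measurableSet_le (measurable_sum_abs_natCast_sub _) measurable_const)]
      simp
  | succ m ih =>
    have hα' : ∀ i : Fin (m + 1), 0 < α i.succ := fun i => hα _
    have hA : 0 < ∑ i : Fin (m + 1), α i.succ := Finset.sum_pos (fun i _ => hα _) (by simp)
    obtain ⟨C, hC⟩ := ih hα'
    obtain ⟨D, hD0, hD⟩ := exists_betaMeasure_partition (hα 0) hA
    choose ρ hρsnd hρfst hρC using hC
    have hdir := isProbabilityMeasure_dirichletMeasure hα'
    have hbeta := isProbabilityMeasureBeta (hα 0) hA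
    set μ := betaMeasure (α 0) (∑ i : Fin (m + 1), α i.succ) with hμ
    have hρprob : ∀ n, IsProbabilityMeasure (ρ n) := fun n => by
      have : IsProbabilityMeasure ((ρ n).map Prod.snd) := by rw [hρsnd n]; exact hdir
      exact Measure.isProbabilityMeasure_of_map (f := Prod.snd) (μ := ρ n)
    refine ⟨C + 2 * (D + 2), fun n => ?_⟩
    obtain ⟨t, htm, ht0, ht1, htI, htD⟩ := hD n
    -- Quantile coupling of the first colour: when the beta variable falls in the `k`-th interval
    -- the first count is `k`, and the rest is an independent copy of the coupling for `n - k`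
    -- draws.
    refine ⟨Measure.sum fun k => ((μ.restrict (Set.Ioc (t k) (t (k + 1)))).prod (ρ (n - k))).map
      (consCouple k), ?_, fun k => ?_, ?_⟩
    · have hk : ∀ k, (((μ.restrict (Set.Ioc (t k) (t (k + 1)))).prod (ρ (n - k))).map
          (consCouple k)).map Prod.snd
          = ((μ.restrict (Set.Ioc (t k) (t (k + 1)))).prod
              (dirichletMeasure fun i : Fin (m + 1) => α i.succ)).map
              fun z => stickBreak z.1 z.2 := by
        intro k
        rw [Measure.map_map measurable_snd measurable_consCouple, ← hρsnd (n - k)]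
        nth_rewrite 2 [← Measure.map_id (μ := μ.restrict _)]
        rw [Measure.map_prod_map _ _ measurable_id measurable_snd,
          Measure.map_map measurable_stickBreak (by fun_prop)]
        rfl
      rw [Measure.map_sum measurable_snd.aemeasurable]
      simp_rw [hk]
      have hsum := Measure.restrict_iUnion (μ := μ) htm.pairwise_disjoint_on_Ioc_succ
        fun _ => measurableSet_Ioc
      simp only [Nat.succ_eq_succ, Nat.succ_eq_add_one] at hsum
      rw [← Measure.map_sum measurable_stickBreak.aemeasurable, ← Measure.prod_sum_left, ← hsum,
        Measure.restrict_eq_self_of_ae_mem (iUnion_Ioc_ae_univ ht0 ht1),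
        dirichletMeasure_eq_map_stickBreak hα]
    · have hmeas : ∀ {r : ℕ} (k : Fin r → ℕ),
          MeasurableSet {z : (Fin r → ℕ) × (Fin r → ℝ) | z.1 = k} := fun k =>
        measurable_fst (measurableSet_singleton k)
      rw [Measure.sum_apply _ (hmeas k), tsum_eq_single (k 0)]
      · rw [Measure.map_apply measurable_consCouple (hmeas k)]
        have hpre : consCouple (k 0) ⁻¹' {z | z.1 = k}
            = Set.univ ×ˢ {z : (Fin (m + 1) → ℕ) × (Fin (m + 1) → ℝ) |
                z.1 = fun i => k i.succ} := by
          ext z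
          simp only [consCouple, Set.mem_preimage, Set.mem_ofPred_eq, Set.mem_prod, Set.mem_univ,
            true_and]
          rw [funext_iff, Fin.forall_fin_succ, funext_iff]
          simp
        rw [hpre, Measure.prod_prod, Measure.restrict_apply_univ, htI, hρfst]
        by_cases hn : ∑ i, k i = n
        · have hn' := hn
          rw [Fin.sum_univ_succ] at hn'
          rw [if_pos hn, if_pos (by omega), urnPmf_eq_mul hα, hn,
            ENNReal.ofReal_mul (betaBinomial_nonneg (hα 0) hA _ _)]
        · have hn' := hn
          rw [Fin.sum_univ_succ] at hn'
          rw [if_neg hn]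
          rcases le_or_gt (k 0) n with h | h
          · rw [if_neg (by omega), mul_zero]
          · rw [betaBinomial_of_lt _ _ h, ENNReal.ofReal_zero, zero_mul]
      -- The `j`-th piece only produces vectors whose first count is `j`.
      · intro j hj
        rw [Measure.map_apply measurable_consCouple (hmeas k)]
        convert measure_empty (μ := (μ.restrict (Set.Ioc (t j) (t (j + 1)))).prod (ρ (n - j)))
        ext z
        simp only [consCouple, Set.mem_preimage, Set.mem_ofPred_eq, Set.mem_empty_iff_false,
          iff_false]
        exact fun h => hj (by rw [← h]; rfl)
    · rw [Measure.ae_sum_iff]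
      intro k
      rw [ae_map_iff measurable_consCouple.aemeasurable
        (measurableSet_le (measurable_sum_abs_natCast_sub _) measurable_const)]
      rcases lt_or_ge n k with hk | hk
      -- For `k > n` the truncated difference `n - k` is meaningless, but the piece has no mass.
      · have : μ.restrict (Set.Ioc (t k) (t (k + 1))) = 0 := by
          rw [Measure.restrict_eq_zero, htI, betaBinomial_of_lt _ _ hk, ENNReal.ofReal_zero]
        rw [this]
        simp
      have hw : ∀ᵐ z ∂ρ (n - k), (∀ i, 0 < z.2 i) ∧ ∑ i, z.2 i = 1 := by
        have := ae_dirichletMeasure fun i : Fin (m + 1) => α i.succ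
        rw [← hρsnd (n - k)] at this
        exact ae_of_ae_map measurable_snd.aemeasurable this
      have hb : ∀ᵐ b ∂μ.restrict (Set.Ioc (t k) (t (k + 1))), b ∈ Set.Ioo (0 : ℝ) 1 :=
        ae_restrict_of_ae (ae_betaMeasure_mem_Ioo _ _)
      filter_upwards [Measure.quasiMeasurePreserving_fst.ae hb,
        Measure.quasiMeasurePreserving_fst.ae
          (ae_restrict_mem (measurableSet_Ioc (a := t k) (b := t (k + 1)))),
        Measure.quasiMeasurePreserving_snd.ae hw,
        Measure.quasiMeasurePreserving_snd.ae (hρC (n - k))] with z hz1 hz2 hz3 hz4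
      refine sum_abs_stickBreak_le hk hz3.1 hz3.2 ?_ hz4
      -- The partition controls `(n + 1) * b`. The width of one cell and the passage to `n * b` are
      -- absorbed in the `2` of `D + 2`.
      have hN : (0 : ℝ) < n + 1 := by positivity
      have h1 := abs_le.1 (htD k (by omega))
      have h2 := abs_le.1 (htD (k + 1) (by omega))
      have h3 := mul_lt_mul_of_pos_left hz2.1 hN
      have h4 := mul_le_mul_of_nonneg_left hz2.2 hN.le
      have h5 := hz1.1
      have h6 := hz1.2
      push_cast at h2
      rw [abs_le]
      constructor <;> linarith [h1.1, h1.2, h2.1, h2.2]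

/-! ### The law of the draw counts. -/

/-- The number of occurrences of each colour among the first `n` terms of `c`. -/
def colourCount {q : ℕ} (c : ℕ → Fin q) (n : ℕ) (i : Fin q) : ℕ :=
  ((Finset.range n).filter fun j => c j = i).card

lemma colourCount_succ {q : ℕ} (c : ℕ → Fin q) (n : ℕ) :
    colourCount c (n + 1) = colourCount c n + Pi.single (c n) 1 := by
  ext i
  rw [Pi.add_apply, colourCount, colourCount, Finset.range_add_one, Finset.filter_insert]
  split_ifs with h
  · subst h; simp
  · simp [Pi.single_eq_of_ne (Ne.symm h)]

lemma sum_colourCount {q : ℕ} (c : ℕ → Fin q) (n : ℕ) : ∑ i, colourCount c n i = n := by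
  induction n with
  | zero => simp [colourCount]
  | succ n ih => simp [colourCount_succ, Finset.sum_add_distrib, ih]

/-- The composition of the urn after the colours `c 0, …, c (n - 1)` have been drawn. -/
def composition {q : ℕ} (a : ℝ) (x₀ : Fin q → ℝ) (c : ℕ → Fin q) (n : ℕ) (i : Fin q) : ℝ :=
  x₀ i + a * colourCount c n i

lemma composition_zero {q : ℕ} (a : ℝ) (x₀ : Fin q → ℝ) (c : ℕ → Fin q) :
    composition a x₀ c 0 = x₀ := by
  ext i; simp [composition, colourCount]

lemma composition_succ {q : ℕ} (a : ℝ) (x₀ : Fin q → ℝ) (c : ℕ → Fin q) (n : ℕ) :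
    composition a x₀ c (n + 1) = composition a x₀ c n + Pi.single (c n) a := by
  ext i
  rw [Pi.add_apply, composition, composition, colourCount_succ, Pi.add_apply]
  by_cases h : i = c n
  · subst h; simp; ring
  · simp [Pi.single_eq_of_ne h]

lemma sum_composition {q : ℕ} (a : ℝ) (x₀ : Fin q → ℝ) (c : ℕ → Fin q) (n : ℕ) :
    ∑ i, composition a x₀ c n i = ∑ i, x₀ i + a * n := by
  simp only [composition, Finset.sum_add_distrib, ← Finset.mul_sum, ← Nat.cast_sum, sum_colourCount]

lemma composition_congr {q : ℕ} (a : ℝ) (x₀ : Fin q → ℝ) {c c' : ℕ → Fin q} {n : ℕ}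
    (h : ∀ j < n, c j = c' j) : composition a x₀ c n = composition a x₀ c' n := by
  ext i
  rw [composition, composition, colourCount, colourCount]
  rw [Finset.filter_congr fun j hj => by rw [h j (Finset.mem_range.1 hj)]]

/-- The event that the first `n` drawn colours are given by `c`. -/
def historyEvent {q : ℕ} {Ω : Type*} (a : ℝ) (x₀ : Fin q → ℝ) (X : ℕ → Ω → Fin q → ℝ)
    (c : ℕ → Fin q) (n : ℕ) : Set Ω :=
  {ω | ∀ k ≤ n, X k ω = composition a x₀ c k}

lemma drawCount_succ {q : ℕ} {Ω : Type*} [MeasurableSpace Ω] {a : ℝ} (ha : a ≠ 0)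
    {X : ℕ → Ω → Fin q → ℝ} {n : ℕ} {ω : Ω} {i : Fin q}
    (h : X (n + 1) ω = X n ω + Pi.single i a) :
    drawCount a X (n + 1) ω = drawCount a X n ω + Pi.single i 1 := by
  ext j
  rw [Pi.add_apply, drawCount, drawCount, Finset.range_add_one, Finset.filter_insert, h]
  by_cases hij : j = i
  · subst hij; simp
  · have : (Pi.single i a : Fin q → ℝ) ≠ Pi.single j a := fun he => by
      have := congrFun he i
      rw [Pi.single_eq_same, Pi.single_eq_of_ne (Ne.symm hij)] at this
      exact ha this
    simp [this, Pi.single_eq_of_ne hij]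

lemma drawCount_of_mem_historyEvent {q : ℕ} {Ω : Type*} [MeasurableSpace Ω] {a : ℝ} (ha : a ≠ 0)
    {x₀ : Fin q → ℝ} {X : ℕ → Ω → Fin q → ℝ} {c : ℕ → Fin q} {n : ℕ} {ω : Ω}
    (h : ω ∈ historyEvent a x₀ X c n) : drawCount a X n ω = colourCount c n := by
  induction n with
  | zero => ext i; simp [drawCount, colourCount]
  | succ n ih =>
    rw [colourCount_succ, ← ih fun k hk => h k (by omega)]
    refine drawCount_succ ha ?_
    rw [h (n + 1) le_rfl, h n (by omega), composition_succ]

section Law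

variable {q : ℕ} {Ω : Type*} [MeasurableSpace Ω] {a : ℝ} {x₀ : Fin q → ℝ} {P : Measure Ω}
  {X : ℕ → Ω → Fin q → ℝ}

lemma measurableSet_draw (hX : IsPolyaUrn a x₀ P X) (n : ℕ) (i : Fin q) :
    MeasurableSet {ω | X (n + 1) ω = X n ω + Pi.single i a} :=
  measurableSet_eq_fun (hX.measurable _) ((hX.measurable _).add_const _)

lemma measurable_drawCount (hX : IsPolyaUrn a x₀ P X) (n : ℕ) :
    Measurable (drawCount a X n) := by
  classical
  rw [measurable_pi_iff]
  intro i
  have h : (fun ω => drawCount a X n ω i) = fun ω => ∑ k ∈ Finset.range n,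
      if X (k + 1) ω = X k ω + Pi.single i a then 1 else 0 := by
    ext ω
    rw [drawCount, Finset.card_filter]
  rw [h]
  exact Finset.measurable_sum _ fun k _ =>
    Measurable.ite (measurableSet_draw hX k i) measurable_const measurable_const

lemma measurableSet_historyEvent (hX : IsPolyaUrn a x₀ P X) (c : ℕ → Fin q) (n : ℕ) :
    MeasurableSet (historyEvent a x₀ X c n) := by
  rw [historyEvent, Set.ofPred_forall]
  refine MeasurableSet.iInter fun k => ?_
  rw [Set.ofPred_forall]
  exact MeasurableSet.iInter fun _ => hX.measurable k (measurableSet_singleton _)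

variable [IsProbabilityMeasure P]

lemma measure_historyEvent_inter_draw (hX : IsPolyaUrn a x₀ P X) (c : ℕ → Fin q) (n : ℕ)
    (i : Fin q) :
    P (historyEvent a x₀ X c n ∩ {ω | X (n + 1) ω = X n ω + Pi.single i a})
      = ENNReal.ofReal (composition a x₀ c n i / (∑ j, x₀ j + a * n))
        * P (historyEvent a x₀ X c n) := by
  have hset : historyEvent a x₀ X c n ∩ {ω | X (n + 1) ω = X n ω + Pi.single i a}
      = historyEvent a x₀ X c n ∩ {ω | X (n + 1) ω = composition a x₀ c n + Pi.single i a} := by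
    ext ω
    refine and_congr_right fun h => ?_
    rw [Set.mem_ofPred_eq, Set.mem_ofPred_eq, h n le_rfl]
  rw [hset]
  by_cases h0 : P (historyEvent a x₀ X c n) = 0
  · rw [h0, mul_zero]
    exact measure_mono_null Set.inter_subset_left h0
  · have h := hX.step n (composition a x₀ c) i h0
    rw [← sum_composition, ← h]
    change _ = P[_ | historyEvent a x₀ X c n] * _
    rw [cond_mul_eq_inter (measurableSet_historyEvent hX c n)]

/-- The colour sequence with first terms `l` and arbitrary further terms. -/
def extendColours [NeZero q] {n : ℕ} (l : Fin n → Fin q) (j : ℕ) : Fin q :=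
  if h : j < n then l ⟨j, h⟩ else 0

/-- On every history the probabilities of the `q` moves sum to one, so almost surely one of them
occurs. By induction the finitely many urn histories carry all the mass. -/
lemma ae_mem_historyEvent [NeZero q] (ha : 0 < a) (hx₀ : ∀ i, 0 < x₀ i)
    (hX : IsPolyaUrn a x₀ P X) (n : ℕ) :
    ∀ᵐ ω ∂P, ∃ l : Fin n → Fin q, ω ∈ historyEvent a x₀ X (extendColours l) n := by
  have hS : 0 < ∑ j, x₀ j := Finset.sum_pos (fun i _ => hx₀ i) Finset.univ_nonempty
  induction n with
  | zero =>
    filter_upwards [hX.initial] with ω hω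
    refine ⟨Fin.elim0, fun k hk => ?_⟩
    rw [Nat.le_zero.1 hk, hω, composition_zero]
  | succ n ih =>
    have hstep : ∀ l : Fin n → Fin q, ∀ᵐ ω ∂P, ω ∈ historyEvent a x₀ X (extendColours l) n →
        ∃ i, X (n + 1) ω = X n ω + Pi.single i a := by
      intro l
      set H := historyEvent a x₀ X (extendColours l) n with hH
      have hHm : MeasurableSet H := measurableSet_historyEvent hX _ n
      have hU : P (⋃ i, H ∩ {ω | X (n + 1) ω = X n ω + Pi.single i a}) = P H := by
        rw [measure_iUnion _ fun i => hHm.inter (measurableSet_draw hX n i), tsum_fintype]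
        · simp_rw [hH, measure_historyEvent_inter_draw hX]
          rw [← Finset.sum_mul, ← ENNReal.ofReal_sum_of_nonneg, ← Finset.sum_div, sum_composition,
            div_self (by positivity), ENNReal.ofReal_one, one_mul]
          intro i _
          have := hx₀ i
          unfold composition
          positivity
        · intro i j hij
          refine Set.disjoint_left.2 fun ω h1 h2 => hij ?_
          have h3 := h1.2.symm.trans h2.2
          have h4 := congrFun (add_left_cancel h3) i
          by_contra hne
          rw [Pi.single_eq_same, Pi.single_eq_of_ne hne] at h4
          exact ha.ne' h4
      rw [← Set.inter_iUnion] at hU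
      have hdiff := measure_sdiff_add_inter (μ := P) H
        (MeasurableSet.iUnion fun i => measurableSet_draw hX n i)
      rw [hU] at hdiff
      have h0 : P (H \ ⋃ i, {ω | X (n + 1) ω = X n ω + Pi.single i a}) = 0 :=
        (ENNReal.add_left_inj (measure_ne_top P H)).1 (hdiff.trans (zero_add _).symm)
      refine measure_mono_null (fun ω hω => ?_) h0
      simp only [Set.mem_compl_iff, Set.mem_ofPred_eq, Classical.not_imp] at hω
      exact ⟨hω.1, by simpa using hω.2⟩
    filter_upwards [ih, ae_all_iff.2 hstep] with ω ⟨l, hl⟩ h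
    obtain ⟨i, hi⟩ := h l hl
    refine ⟨Fin.snoc l i, fun k hk => ?_⟩
    have hext : ∀ j < n, extendColours (Fin.snoc l i : Fin (n + 1) → Fin q) j
        = extendColours l j := by
      intro j hj
      simp [extendColours, hj, Nat.lt_succ_of_lt hj, Fin.snoc]
    rcases Nat.le_succ_iff.1 hk with hk | rfl
    · rw [hl k hk]
      exact composition_congr _ _ fun j hj => (hext j (by omega)).symm
    · rw [Nat.succ_eq_add_one, hi, hl n le_rfl, composition_succ, composition_congr _ _ hext]
      simp [extendColours, Fin.snoc]

/-- Two events whose probabilities on every history differ by the same factor. -/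
lemma measure_eq_mul_of_historyEvent [NeZero q] (ha : 0 < a) (hx₀ : ∀ i, 0 < x₀ i)
    (hX : IsPolyaUrn a x₀ P X) (n : ℕ) {A B : Set Ω} {r : ℝ≥0∞}
    (h : ∀ c, P (historyEvent a x₀ X c n ∩ A) = r * P (historyEvent a x₀ X c n ∩ B)) :
    P A = r * P B := by
  classical
  let hist : Ω → Fin (n + 1) → Fin q → ℝ := fun ω k => X k ω
  let S : Finset (Fin (n + 1) → Fin q → ℝ) :=
    Finset.univ.image fun (l : Fin n → Fin q) k => composition a x₀ (extendColours l) k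
  have hhist : Measurable hist := measurable_pi_iff.2 fun k => hX.measurable k
  have hfib : ∀ l : Fin n → Fin q,
      hist ⁻¹' {fun k : Fin (n + 1) => composition a x₀ (extendColours l) k}
        = historyEvent a x₀ X (extendColours l) n := by
    intro l
    ext ω
    simp only [hist, Set.mem_preimage, Set.mem_singleton_iff, funext_iff (β := fun _ => Fin q → ℝ),
      historyEvent, Set.mem_ofPred_eq]
    exact ⟨fun h k hk => h ⟨k, Nat.lt_succ_of_le hk⟩, fun h k => h k (Nat.lt_succ_iff.1 k.2)⟩
  -- Different colour sequences might encode equal histories, so the decomposition runs over the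
  -- finite set of histories themselves, avoiding repetitions.
  have hsum : ∀ A, P A = ∑ s ∈ S, P (hist ⁻¹' {s} ∩ A) := by
    intro A
    have h1 := sum_measure_preimage_singleton (μ := P.restrict A) S (f := hist)
      fun s _ => hhist (measurableSet_singleton s)
    have h2 : (P.restrict A) (hist ⁻¹' S) = P A := by
      rw [← Measure.restrict_apply_univ A]
      refine measure_congr (ae_eq_univ_iff_measure_eq
        (hhist S.measurableSet).nullMeasurableSet |>.2 ?_ : hist ⁻¹' S =ᵐ[P.restrict A] Set.univ)
      refine measure_congr (Filter.eventuallyEq_univ.2 (ae_restrict_of_ae ?_))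
      filter_upwards [ae_mem_historyEvent ha hx₀ hX n] with ω ⟨l, hl⟩
      rw [← hfib] at hl
      exact Finset.mem_coe.2 (Finset.mem_image.2 ⟨l, Finset.mem_univ _, hl.symm⟩)
    rw [← h2, ← h1]
    exact Finset.sum_congr rfl fun s _ =>
      Measure.restrict_apply (hhist (measurableSet_singleton s))
  rw [hsum A, hsum B, Finset.mul_sum]
  refine Finset.sum_congr rfl fun s hs => ?_
  obtain ⟨l, -, rfl⟩ := Finset.mem_image.1 hs
  rw [hfib]
  exact h _

/-- The next-colour probability depends on the history only through the counts, so it is the same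
factor on all histories compatible with `k`. -/
lemma measure_drawCount_inter_draw [NeZero q] (ha : 0 < a) (hx₀ : ∀ i, 0 < x₀ i)
    (hX : IsPolyaUrn a x₀ P X) (n : ℕ) (k : Fin q → ℕ) (i : Fin q) :
    P ({ω | drawCount a X n ω = k} ∩ {ω | X (n + 1) ω = X n ω + Pi.single i a})
      = ENNReal.ofReal ((x₀ i / a + k i) / (∑ j, x₀ j / a + n))
        * P {ω | drawCount a X n ω = k} := by
  refine measure_eq_mul_of_historyEvent ha hx₀ hX n fun c => ?_
  by_cases hc : colourCount c n = k
  · have hH : historyEvent a x₀ X c n ∩ {ω | drawCount a X n ω = k}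
        = historyEvent a x₀ X c n :=
      Set.inter_eq_left.2 fun ω hω => (drawCount_of_mem_historyEvent ha.ne' hω).trans hc
    rw [← Set.inter_assoc, hH, measure_historyEvent_inter_draw hX, composition, hc]
    congr 2
    rw [← Finset.sum_div]
    field_simp
  · have hH : historyEvent a x₀ X c n ∩ {ω | drawCount a X n ω = k} = ∅ := by
      refine Set.eq_empty_of_forall_notMem fun ω hω => hc ?_
      rw [← drawCount_of_mem_historyEvent ha.ne' hω.1]
      exact hω.2
    rw [← Set.inter_assoc, hH]
    simp

lemma ae_drawCount [NeZero q] (ha : 0 < a) (hx₀ : ∀ i, 0 < x₀ i) (hX : IsPolyaUrn a x₀ P X)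
    (n : ℕ) : ∀ᵐ ω ∂P, ∑ i, drawCount a X n ω i = n ∧
      (∀ i, X n ω i = x₀ i + a * drawCount a X n ω i) := by
  filter_upwards [ae_mem_historyEvent ha hx₀ hX n] with ω ⟨l, hl⟩
  rw [drawCount_of_mem_historyEvent ha.ne' hl, sum_colourCount, hl n le_rfl]
  exact ⟨rfl, fun i => rfl⟩

lemma ae_exists_draw [NeZero q] (ha : 0 < a) (hx₀ : ∀ i, 0 < x₀ i) (hX : IsPolyaUrn a x₀ P X)
    (n : ℕ) : ∀ᵐ ω ∂P, ∃ i, X (n + 1) ω = X n ω + Pi.single i a := by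
  filter_upwards [ae_mem_historyEvent ha hx₀ hX (n + 1)] with ω ⟨l, hl⟩
  exact ⟨_, by rw [hl (n + 1) le_rfl, hl n (by omega), composition_succ]⟩

end Law

/-- Exchangeability: given the final counts, the last draw has colour `i` with probability
proportional to the final count of that colour. -/
lemma urnPmf_add_single {q : ℕ} [NeZero q] {α : Fin q → ℝ} (hα : ∀ i, 0 < α i) (k : Fin q → ℕ)
    (i : Fin q) :
    (α i + k i) / (∑ j, α j + (∑ j, k j : ℕ)) * urnPmf α k
      = urnPmf α (k + Pi.single i 1) * ((k i + 1) / ((∑ j, k j : ℕ) + 1)) := by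
  have hA : 0 < ∑ j, α j := Finset.sum_pos (fun i _ => hα i) Finset.univ_nonempty
  have h1 : ∏ j, risingWeight (α j) ((k + Pi.single i 1 : Fin q → ℕ) j)
      = (∏ j, risingWeight (α j) (k j)) * ((α i + k i) / (k i + 1)) := by
    rw [← Finset.mul_prod_erase _ _ (Finset.mem_univ i),
      ← Finset.mul_prod_erase Finset.univ (fun j => risingWeight (α j) (k j)) (Finset.mem_univ i),
      Pi.add_apply, Pi.single_eq_same, risingWeight_succ,
      Finset.prod_congr (s₁ := Finset.univ.erase i) rfl fun j hj => by
        rw [Pi.add_apply, Pi.single_eq_of_ne (Finset.ne_of_mem_erase hj), add_zero]]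
    ring
  have h2 : ∑ j, (k + Pi.single i 1 : Fin q → ℕ) j = ∑ j, k j + 1 := by simp [Finset.sum_add_distrib]
  have := (risingWeight_pos hA (∑ j, k j)).ne'
  have : (∑ j, α j) + (∑ j, k j : ℕ) ≠ 0 := by positivity
  rw [urnPmf, urnPmf, h1, h2, risingWeight_succ]
  field_simp

/-- The law of the draw counts of a Pólya urn. -/
theorem measure_drawCount_eq {q : ℕ} [NeZero q] {Ω : Type*} [MeasurableSpace Ω] {a : ℝ}
    {x₀ : Fin q → ℝ} {P : Measure Ω} [IsProbabilityMeasure P] {X : ℕ → Ω → Fin q → ℝ}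
    (ha : 0 < a) (hx₀ : ∀ i, 0 < x₀ i) (hX : IsPolyaUrn a x₀ P X) (n : ℕ) (k : Fin q → ℕ) :
    P {ω | drawCount a X n ω = k}
      = if ∑ i, k i = n then ENNReal.ofReal (urnPmf (fun i => x₀ i / a) k) else 0 := by
  have hα : ∀ i, 0 < x₀ i / a := fun i => div_pos (hx₀ i) ha
  by_cases hn : ∑ i, k i = n
  swap
  · rw [if_neg hn]
    refine measure_mono_null (fun ω hω => ?_) (ae_drawCount ha hx₀ hX n)
    exact fun h => hn (by rw [← h.1, hω])
  rw [if_pos hn]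
  induction n generalizing k with
  | zero =>
    have hk : k = 0 := by
      ext i
      exact Finset.sum_eq_zero_iff.1 hn i (Finset.mem_univ i)
    have : {ω | drawCount a X 0 ω = k} = Set.univ := by
      ext ω
      simp [hk, drawCount, funext_iff]
    rw [this, measure_univ, hk, urnPmf]
    simp
  | succ n ih =>
    set D := fun i => {ω | X (n + 1) ω = X n ω + Pi.single i a} with hD
    -- Split by the last colour drawn. The contributions are `k i / (n + 1)` times the claimed mass
    -- and add up to it.
    have hpart : P {ω | drawCount a X (n + 1) ω = k}
        = ∑ i, P ({ω | drawCount a X (n + 1) ω = k} ∩ D i) := by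
      rw [← tsum_fintype (L := .unconditional _), ← measure_iUnion, ← Set.inter_iUnion]
      · refine measure_congr ?_
        filter_upwards [ae_exists_draw ha hx₀ hX n] with ω hω
        refine propext ⟨fun h => ⟨h, Set.mem_iUnion.2 hω⟩, fun h => h.1⟩
      · intro i j hij
        refine Set.disjoint_left.2 fun ω h1 h2 => hij ?_
        have h4 := congrFun (add_left_cancel (h1.2.symm.trans h2.2)) i
        by_contra hne
        rw [Pi.single_eq_same, Pi.single_eq_of_ne hne] at h4
        exact ha.ne' h4
      · exact fun i => (measurable_drawCount hX _ (measurableSet_singleton k)).inter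
          (measurableSet_draw hX n i)
    have hU : 0 ≤ urnPmf (fun i => x₀ i / a) k :=
      div_nonneg (Finset.prod_nonneg fun i _ => (risingWeight_pos (hα i) _).le)
        (risingWeight_pos (Finset.sum_pos (fun i _ => hα i) Finset.univ_nonempty) _).le
    have hterm : ∀ i, P ({ω | drawCount a X (n + 1) ω = k} ∩ D i)
        = ENNReal.ofReal (urnPmf (fun i => x₀ i / a) k * (k i / (n + 1))) := by
      intro i
      rcases Nat.eq_zero_or_pos (k i) with h0 | h0
      · rw [h0]
        simp only [Nat.cast_zero, zero_div, mul_zero, ENNReal.ofReal_zero]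
        convert measure_empty (μ := P)
        refine Set.eq_empty_of_forall_notMem fun ω hω => ?_
        have h1 := congrFun (drawCount_succ ha.ne' hω.2) i
        have h2 : drawCount a X (n + 1) ω = k := hω.1
        rw [h2, h0] at h1
        simp at h1
      · obtain ⟨k', rfl⟩ : ∃ k' : Fin q → ℕ, k = k' + Pi.single i 1 := by
          refine ⟨k - Pi.single i 1, (tsub_add_cancel_of_le ?_).symm⟩
          intro j
          by_cases hj : j = i
          · subst hj; simpa [Nat.one_le_iff_ne_zero, Nat.pos_iff_ne_zero] using h0
          · simp [Pi.single_eq_of_ne hj]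
        have hsum : ∑ j, k' j = n := by
          simpa [Finset.sum_add_distrib] using hn
        have hset : {ω | drawCount a X (n + 1) ω = k' + Pi.single i 1} ∩ D i
            = {ω | drawCount a X n ω = k'} ∩ D i := by
          ext ω
          refine and_congr_left fun h => ?_
          rw [Set.mem_ofPred_eq, Set.mem_ofPred_eq, drawCount_succ ha.ne' h]
          exact add_left_inj _
        have hpos := hα i
        have hA : 0 < ∑ j, x₀ j / a := Finset.sum_pos (fun i _ => hα i) Finset.univ_nonempty
        have hkey := urnPmf_add_single hα k' i
        rw [hset, measure_drawCount_inter_draw ha hx₀ hX, ih k' hsum,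
          ← ENNReal.ofReal_mul (by positivity)]
        congr 1
        rw [hsum] at hkey
        rw [hkey]
        simp
    rw [hpart, Finset.sum_congr rfl fun i _ => hterm i,
      ← ENNReal.ofReal_sum_of_nonneg fun i _ => by positivity, ← Finset.mul_sum, ← Finset.sum_div,
      ← Nat.cast_sum, hn]
    push_cast
    rw [div_self (by positivity), mul_one]

/-! ### The lower bound: distance from a lattice. -/

/-- The distance from `x` to the lattice `h (ℤ + θ)`. -/
noncomputable def latticeDist (h θ x : ℝ) : ℝ :=
  h * |(x / h - θ) - round (x / h - θ)|

lemma measurable_latticeDist (h θ : ℝ) : Measurable (latticeDist h θ) := by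
  unfold latticeDist
  simp_rw [abs_sub_round_eq_min]
  have h1 : Measurable fun x : ℝ => Int.fract (x / h - θ) := measurable_fract.comp (by fun_prop)
  exact (h1.min (h1.const_sub 1)).const_mul h

lemma latticeDist_le {h : ℝ} (hh : 0 < h) (θ x : ℝ) (k : ℤ) :
    latticeDist h θ x ≤ |h * (k + θ) - x| := by
  calc latticeDist h θ x ≤ h * |(x / h - θ) - k| :=
        mul_le_mul_of_nonneg_left (round_le _ _) hh.le
    _ = |h * (k + θ) - x| := by
        rw [← abs_of_pos hh, ← abs_mul, abs_of_pos hh, ← abs_neg]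
        congr 1
        field_simp
        ring

/-- Two points half a spacing apart cannot both be close to the lattice: distinct lattice points are
at least one spacing apart. -/
lemma half_le_latticeDist_add {h : ℝ} (hh : 0 < h) (θ x : ℝ) :
    h / 2 ≤ latticeDist h θ x + latticeDist h θ (x + h / 2) := by
  have hx : (x + h / 2) / h - θ = (x / h - θ) + 1 / 2 := by field_simp; ring
  rw [latticeDist, latticeDist, hx, ← mul_add]
  set y := x / h - θ
  set k := round y
  set l := round (y + 1 / 2)
  have h1 : (1 : ℝ) / 2 ≤ |1 / 2 + ((k - l : ℤ) : ℝ)| := by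
    rcases le_or_gt 0 (k - l) with hkl | hkl
    · have : (0 : ℝ) ≤ ((k - l : ℤ) : ℝ) := by exact_mod_cast hkl
      exact le_trans (by linarith) (le_abs_self _)
    · have : ((k - l : ℤ) : ℝ) ≤ -1 := by exact_mod_cast Int.le_sub_one_of_lt hkl
      exact le_trans (by linarith) (neg_le_abs _)
  have h2 : 1 / 2 + ((k - l : ℤ) : ℝ) = (y + 1 / 2 - l) - (y - k) := by push_cast; ring
  have h3 := abs_sub (y + 1 / 2 - l) (y - k)
  rw [← h2] at h3
  nlinarith

/-- Pair `x` with `x + h / 2` and use a positive lower bound `δ` for the density on `[1/8, 7/8]`.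
Since `h ≤ 1`, both points stay there for `x` in `[1/8, 3/8]`. This interval has length `1/4` and
each pair gives `h / 2`, whence `δ / 16` after halving. -/
lemma exists_le_lintegral_betaMeasure {α β : ℝ} (hα : 0 < α) (hβ : 0 < β) :
    ∃ c : ℝ, 0 < c ∧ ∀ h : ℝ, 0 < h → h ≤ 1 → ∀ θ : ℝ,
      ENNReal.ofReal (c * h) ≤ ∫⁻ b, ENNReal.ofReal (latticeDist h θ b) ∂betaMeasure α β := by
  have hcont : ContinuousOn (fun x : ℝ => 1 / beta α β * x ^ (α - 1) * (1 - x) ^ (β - 1))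
      (Set.Icc (1 / 8) (7 / 8)) := by
    refine (continuousOn_const.mul (ContinuousOn.rpow_const continuousOn_id fun x hx => ?_)).mul
      (ContinuousOn.rpow_const (by fun_prop) fun x hx => ?_)
    · exact Or.inl (by simp only [id]; linarith [hx.1])
    · exact Or.inl (by linarith [hx.2])
  obtain ⟨x₀, hx₀, hmin⟩ := isCompact_Icc.exists_isMinOn (Set.nonempty_Icc.2 (by norm_num)) hcont
  set δ := 1 / beta α β * x₀ ^ (α - 1) * (1 - x₀) ^ (β - 1) with hδ
  have hδ0 : 0 < δ := by
    have := beta_pos hα hβ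
    have h1 : 0 < x₀ := by linarith [hx₀.1]
    have h2 : 0 < 1 - x₀ := by linarith [hx₀.2]
    positivity
  refine ⟨δ / 16, by positivity, fun h hh hh1 θ => ?_⟩
  set J : Set ℝ := Set.Icc (1 / 8) (7 / 8) with hJ
  set G : ℝ → ℝ≥0∞ := fun x => ENNReal.ofReal (latticeDist h θ x) with hG
  have hGm : Measurable G := (measurable_latticeDist h θ).ennreal_ofReal
  have hnn : ∀ x, 0 ≤ latticeDist h θ x := fun x => mul_nonneg hh.le (abs_nonneg _)
  have hJm : MeasurableSet J := measurableSet_Icc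
  have h1 : ENNReal.ofReal (h / 8) ≤ 2 * ∫⁻ x, J.indicator G x := by
    calc ENNReal.ofReal (h / 8) = ∫⁻ x in Set.Icc (1 / 8 : ℝ) (3 / 8), ENNReal.ofReal (h / 2) := by
          rw [setLIntegral_const, Real.volume_Icc, ← ENNReal.ofReal_mul (by positivity)]
          congr 1; ring
      _ ≤ ∫⁻ x in Set.Icc (1 / 8 : ℝ) (3 / 8), (J.indicator G x + J.indicator G (x + h / 2)) := by
          refine setLIntegral_mono' measurableSet_Icc fun x hx => ?_
          have hxJ : x ∈ J := ⟨hx.1, by linarith [hx.2]⟩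
          have hxJ' : x + h / 2 ∈ J := ⟨by linarith [hx.1], by linarith [hx.2]⟩
          rw [Set.indicator_of_mem hxJ, Set.indicator_of_mem hxJ',
            ← ENNReal.ofReal_add (hnn _) (hnn _)]
          exact ENNReal.ofReal_le_ofReal (half_le_latticeDist_add hh θ x)
      _ ≤ ∫⁻ x, (J.indicator G x + J.indicator G (x + h / 2)) := setLIntegral_le_lintegral _ _
      _ = 2 * ∫⁻ x, J.indicator G x := by
          rw [lintegral_add_left (hGm.indicator hJm),
            lintegral_add_right_eq_self (fun x => J.indicator G x) (h / 2), two_mul]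
  have h2 : ENNReal.ofReal δ * ∫⁻ x, J.indicator G x ≤ ∫⁻ b, G b ∂betaMeasure α β := by
    rw [lintegral_betaMeasure _ _ hGm, ← lintegral_const_mul _ (hGm.indicator hJm)]
    refine lintegral_mono fun x => ?_
    by_cases hx : x ∈ J
    · simp only [Set.indicator_of_mem hx]
      refine mul_le_mul_left ?_ _
      rw [betaPDF_of_pos_lt_one (by linarith [hx.1]) (by linarith [hx.2])]
      exact ENNReal.ofReal_le_ofReal (hmin hx)
    · simp [Set.indicator_of_notMem hx]
  have h3 : ENNReal.ofReal (h / 16) ≤ ∫⁻ x, J.indicator G x := by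
    rw [show h / 8 = 2 * (h / 16) by ring, ENNReal.ofReal_mul (by norm_num),
      ENNReal.ofReal_ofNat] at h1
    exact (ENNReal.mul_le_mul_iff_right (by norm_num) (by norm_num)).1 h1
  refine le_trans ?_ h2
  rw [show δ / 16 * h = δ * (h / 16) by ring, ENNReal.ofReal_mul hδ0.le]
  exact mul_le_mul_right h3 _

lemma lintegral_dirichletMeasure_zero {m : ℕ} {α : Fin (m + 2) → ℝ} (hα : ∀ i, 0 < α i)
    {f : ℝ → ℝ≥0∞} (hf : Measurable f) :
    ∫⁻ w, f (w 0) ∂dirichletMeasure α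
      = ∫⁻ b, f b ∂betaMeasure (α 0) (∑ i : Fin (m + 1), α i.succ) := by
  have := isProbabilityMeasure_dirichletMeasure fun i : Fin (m + 1) => hα i.succ
  rw [dirichletMeasure_eq_map_stickBreak hα, lintegral_map (by fun_prop) measurable_stickBreak]
  have h : ∀ z : ℝ × (Fin (m + 1) → ℝ), f (stickBreak z.1 z.2 0) = f z.1 := fun z => rfl
  simp_rw [h]
  have hf1 : Measurable fun z : ℝ × (Fin (m + 1) → ℝ) => f z.1 := hf.comp measurable_fst
  rw [lintegral_prod _ hf1.aemeasurable]
  simp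

lemma continuous_sum_abs_sub {q : ℕ} :
    Continuous fun z : (Fin q → ℝ) × (Fin q → ℝ) => ∑ i, |z.1 i - z.2 i| := by
  fun_prop

lemma isProbabilityMeasure_of_map_snd {E F : Type*} [MeasurableSpace E] [MeasurableSpace F]
    {π : Measure (E × F)} {ν : Measure F} [hν : IsProbabilityMeasure ν] (h : π.map Prod.snd = ν) :
    IsProbabilityMeasure π := by
  have : IsProbabilityMeasure (π.map Prod.snd) := h ▸ hν
  exact Measure.isProbabilityMeasure_of_map Prod.snd

/-- Distributions with a coordinate in a lattice are far from a Dirichlet distribution. -/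
theorem exists_le_minimalLp {m : ℕ} {α : Fin (m + 2) → ℝ} (hα : ∀ i, 0 < α i) :
    ∃ c : ℝ, 0 < c ∧ ∀ h : ℝ, 0 < h → h ≤ 1 → ∀ (θ : ℝ) (μ : Measure (Fin (m + 2) → ℝ)),
      (∀ᵐ u ∂μ, ∃ k : ℤ, u 0 = h * (k + θ)) → ∀ p : ℝ≥0∞, 1 ≤ p →
      ENNReal.ofReal (c * h) ≤ minimalLp p μ (dirichletMeasure α) := by
  have hA : 0 < ∑ i : Fin (m + 1), α i.succ := Finset.sum_pos (fun i _ => hα _) (by simp)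
  have hdir := isProbabilityMeasure_dirichletMeasure hα
  obtain ⟨c, hc, H⟩ := exists_le_lintegral_betaMeasure (hα 0) hA
  refine ⟨c, hc, fun h hh hh1 θ μ hμ p hp => le_iInf₂ fun π hπ => ?_⟩
  have hprob := isProbabilityMeasure_of_map_snd hπ.map_snd
  -- On a probability space `L_p` norms increase with `p`, so `p = 1` is the hardest case for the
  -- lower bound.
  refine le_trans ?_ (eLpNorm_le_eLpNorm_of_exponent_le hp
    continuous_sum_abs_sub.aestronglyMeasurable)
  have hG : Measurable fun x => ENNReal.ofReal (latticeDist h θ x) :=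
    (measurable_latticeDist h θ).ennreal_ofReal
  rw [eLpNorm_one_eq_lintegral_enorm]
  calc ENNReal.ofReal (c * h)
      ≤ ∫⁻ w, ENNReal.ofReal (latticeDist h θ (w 0)) ∂dirichletMeasure α := by
        rw [lintegral_dirichletMeasure_zero hα hG]; exact H h hh hh1 θ
    _ = ∫⁻ z, ENNReal.ofReal (latticeDist h θ (z.2 0)) ∂π := by
        have hG0 : Measurable fun w : Fin (m + 2) → ℝ => ENNReal.ofReal (latticeDist h θ (w 0)) :=
          hG.comp (measurable_pi_apply 0)
        rw [← hπ.map_snd, lintegral_map hG0 measurable_snd]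
    _ ≤ _ := by
        rw [← hπ.map_fst] at hμ
        refine lintegral_mono_ae ?_
        filter_upwards [ae_of_ae_map measurable_fst.aemeasurable hμ] with z ⟨k, hk⟩
        rw [Real.enorm_of_nonneg (Finset.sum_nonneg fun i _ => abs_nonneg _)]
        refine ENNReal.ofReal_le_ofReal ((latticeDist_le hh θ _ k).trans ?_)
        rw [← hk]
        exact Finset.single_le_sum (f := fun i => |z.1 i - z.2 i|) (fun i _ => abs_nonneg _)
          (Finset.mem_univ 0)

/-! ### From bounded coupling errors to the theorem. -/

/-- Pushing the integer-valued component through `φ` turns a coupling of counts into one of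
normalised vectors; an almost sure bound controls all exponents at once. -/
lemma minimalLp_le_of_coupling {q : ℕ} {K : Type*} [MeasurableSpace K]
    {π : Measure (K × (Fin q → ℝ))} {ν : Measure (Fin q → ℝ)} [IsProbabilityMeasure ν]
    (hν : π.map Prod.snd = ν) {Ω : Type*} [MeasurableSpace Ω] {P : Measure Ω} {Y : Ω → K}
    (hY : Measurable Y) (hπ : π.map Prod.fst = P.map Y) {φ : K → Fin q → ℝ} (hφ : Measurable φ)
    {U : Ω → Fin q → ℝ} (hU : ∀ᵐ ω ∂P, U ω = φ (Y ω)) {C : ℝ}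
    (hC : ∀ᵐ z ∂π, ∑ i, |φ z.1 i - z.2 i| ≤ C) (p : ℝ≥0∞) :
    minimalLp p (P.map U) ν ≤ ENNReal.ofReal C := by
  have hprob := isProbabilityMeasure_of_map_snd hν
  have hm : Measurable fun z : K × (Fin q → ℝ) => (φ z.1, z.2) := by fun_prop
  have hc : IsCoupling (P.map U) ν (π.map fun z => (φ z.1, z.2)) := by
    constructor
    · rw [Measure.map_map measurable_fst hm, Measure.map_congr (g := φ ∘ Y) hU,
        ← Measure.map_map hφ hY, ← hπ, Measure.map_map hφ measurable_fst]
      rfl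
    · rw [Measure.map_map measurable_snd hm, ← hν]
      rfl
  refine (iInf₂_le _ hc).trans ?_
  rw [eLpNorm_map_measure continuous_sum_abs_sub.aestronglyMeasurable hm.aemeasurable]
  refine (eLpNorm_le_of_ae_bound (C := C) ?_).trans (by simp)
  filter_upwards [hC] with z hz
  rw [Function.comp_apply, Real.norm_of_nonneg (Finset.sum_nonneg fun i _ => abs_nonneg _)]
  exact hz

lemma sum_abs_div_sub_le {q : ℕ} {s : ℝ} (hs : 0 < s) {α : Fin q → ℝ} (hα : ∀ i, 0 ≤ α i)
    {k : Fin q → ℕ} {w : Fin q → ℝ} (hw : ∀ i, 0 < w i) (hw1 : ∑ i, w i = 1) {C : ℝ}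
    (h : ∑ i, |(k i : ℝ) - s * w i| ≤ C) :
    ∑ i, |(α i + k i) / (∑ j, α j + s) - w i| ≤ (C + 2 * ∑ j, α j) / s := by
  set A := ∑ j, α j with hAdef
  have hA : 0 ≤ A := Finset.sum_nonneg fun i _ => hα i
  have hC : 0 ≤ C := (Finset.sum_nonneg fun i _ => abs_nonneg _).trans h
  have h1 : ∀ i, |(α i + k i) / (A + s) - w i|
      ≤ (α i + |(k i : ℝ) - s * w i| + A * w i) / (A + s) := by
    intro i
    have e : (α i + k i) / (A + s) - w i = (α i + (k i - s * w i) + -(A * w i)) / (A + s) := by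
      field_simp; ring
    rw [e, abs_div, abs_of_pos (by positivity : 0 < A + s)]
    gcongr
    refine (abs_add_le _ _).trans (add_le_add ((abs_add_le _ _).trans ?_) ?_)
    · rw [abs_of_nonneg (hα i)]
    · rw [abs_neg, abs_of_nonneg (mul_nonneg hA (hw i).le)]
  calc _ ≤ ∑ i, (α i + |(k i : ℝ) - s * w i| + A * w i) / (A + s) :=
        Finset.sum_le_sum fun i _ => h1 i
    _ = (A + ∑ i, |(k i : ℝ) - s * w i| + A) / (A + s) := by
        rw [← Finset.sum_div, Finset.sum_add_distrib, Finset.sum_add_distrib, ← Finset.mul_sum,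
          hw1, mul_one]
    _ ≤ (C + 2 * A) / s := by
        have h2 : A + ∑ i, |(k i : ℝ) - s * w i| + A ≤ C + 2 * A := by linarith
        exact div_le_div₀ (by positivity) h2 hs (by linarith)

theorem theorem1 (q : ℕ) (hq : 2 ≤ q) (a : ℝ) (ha : 0 < a) (x₀ : Fin q → ℝ)
    (hx₀ : ∀ i, 0 < x₀ i) :
    ∃ c C : ℝ, 0 < c ∧ 0 < C ∧
      ∀ (Ω : Type*) [MeasurableSpace Ω] (P : Measure Ω) [IsProbabilityMeasure P]
        (X : ℕ → Ω → Fin q → ℝ), IsPolyaUrn a x₀ P X →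
      ∀ (Ω' : Type*) [MeasurableSpace Ω'] (P' : Measure Ω') [IsProbabilityMeasure P']
        (W : Ω' → Fin q → ℝ), HasLaw W (dirichletMeasure fun i => x₀ i / a) P' →
      ∀ p : ℝ≥0∞, 1 ≤ p → ∀ n : ℕ, 1 ≤ n →
        (ENNReal.ofReal (c / n) ≤
            minimalLp p (P.map fun ω i => X n ω i / ∑ j, X n ω j) (P'.map W) ∧
          minimalLp p (P.map fun ω i => X n ω i / ∑ j, X n ω j) (P'.map W) ≤
            ENNReal.ofReal (C / n)) ∧
        (ENNReal.ofReal (c / n) ≤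
            minimalLp p (P.map fun ω i => (drawCount a X n ω i : ℝ) / n) (P'.map W) ∧
          minimalLp p (P.map fun ω i => (drawCount a X n ω i : ℝ) / n) (P'.map W) ≤
            ENNReal.ofReal (C / n)) := by
  obtain ⟨m, rfl⟩ := Nat.exists_eq_add_of_le' hq
  have hα : ∀ i, 0 < x₀ i / a := fun i => div_pos (hx₀ i) ha
  set α : Fin (m + 2) → ℝ := fun i => x₀ i / a with hαdef
  set A := ∑ i, α i with hAdef
  have hA : 0 < A := Finset.sum_pos (fun i _ => hα i) Finset.univ_nonempty
  have hdir := isProbabilityMeasure_dirichletMeasure hα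
  obtain ⟨c, hc, hlow⟩ := exists_le_minimalLp hα
  obtain ⟨C, hC⟩ := exists_urn_coupling hα
  -- The almost sure bound holds at some point, because the coupling is a probability measure, and a
  -- sum of absolute values is nonnegative.
  have hC0 : 0 ≤ C := by
    obtain ⟨π, hsnd, -, hb⟩ := hC 0
    have := isProbabilityMeasure_of_map_snd hsnd
    obtain ⟨z, hz⟩ := hb.exists
    exact (Finset.sum_nonneg fun i _ => abs_nonneg _).trans hz
  refine ⟨c / (A + 1), C + 2 * A, by positivity, by positivity, ?_⟩
  intro Ω _ P _ X hX Ω' _ P' _ W hW p hp n hn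
  rw [hW.map_eq]
  have hn0 : (0 : ℝ) < n := Nat.cast_pos.2 hn
  have hn1 : (1 : ℝ) ≤ n := Nat.one_le_cast.2 hn
  obtain ⟨π, hsnd, hfst, hb⟩ := hC n
  have hYm := measurable_drawCount hX n
  have hπ : π.map Prod.fst = P.map (drawCount a X n) := by
    refine Measure.ext_of_singleton fun k => ?_
    rw [Measure.map_apply measurable_fst (measurableSet_singleton k),
      Measure.map_apply hYm (measurableSet_singleton k)]
    exact (hfst k).trans (measure_drawCount_eq ha hx₀ hX n k).symm
  have hw : ∀ᵐ z ∂π, (∀ i, 0 < z.2 i) ∧ ∑ i, z.2 i = 1 := by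
    have := ae_dirichletMeasure α
    rw [← hsnd] at this
    exact ae_of_ae_map measurable_snd.aemeasurable this
  have hcast : ∀ i : Fin (m + 2), Measurable fun k : Fin (m + 2) → ℕ => (k i : ℝ) := fun i =>
    (measurable_from_nat (f := fun n : ℕ => (n : ℝ))).comp (measurable_pi_apply i)
  have hXY : ∀ᵐ ω ∂P, (fun i => X n ω i / ∑ j, X n ω j)
      = fun i => (α i + drawCount a X n ω i) / (A + n) := by
    filter_upwards [ae_drawCount ha hx₀ hX n] with ω ⟨h1, h2⟩
    have h3 : ∀ i, X n ω i = a * (α i + drawCount a X n ω i) := fun i => by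
      rw [h2, hαdef]; field_simp
    ext i
    simp_rw [h3]
    rw [← Finset.mul_sum, Finset.sum_add_distrib, ← Nat.cast_sum, h1, mul_div_mul_left _ _ ha.ne']
  have hlat : ∀ h θ : ℝ, MeasurableSet {u : Fin (m + 2) → ℝ | ∃ k : ℤ, u 0 = h * (k + θ)} := by
    intro h θ
    rw [Set.ofPred_exists]
    exact MeasurableSet.iUnion fun k => measurableSet_eq_fun (by fun_prop) measurable_const
  have hXm : Measurable fun ω i => X n ω i / ∑ j, X n ω j := by
    have := hX.measurable n
    fun_prop
  have hYm' : Measurable fun ω i => (drawCount a X n ω i : ℝ) / n :=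
    measurable_pi_iff.2 fun i => ((hcast i).comp hYm).div_const _
  have hcle : ∀ {h : ℝ}, 1 / (A + n) ≤ h →
      ENNReal.ofReal (c / (A + 1) / n) ≤ ENNReal.ofReal (c * h) := by
    intro h hh
    refine ENNReal.ofReal_le_ofReal (le_trans ?_ (mul_le_mul_of_nonneg_left hh hc.le))
    rw [div_div, mul_one_div]
    gcongr
    nlinarith
  refine ⟨⟨?_, ?_⟩, ?_, ?_⟩
  -- The urn proportion is `(α 0 + k) / (A + n)`, so the spacing is `1 / (A + n)` and the offset is
  -- `α 0`. The factor `A + 1` in the constant comes from `A + n ≤ (A + 1) * n`.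
  · refine (hcle le_rfl).trans (hlow (1 / (A + n)) (by positivity) ?_ (α 0) _ ?_ p hp)
    · rw [div_le_one (by positivity)]; linarith
    · rw [ae_map_iff hXm.aemeasurable (hlat _ _)]
      filter_upwards [hXY] with ω hω
      refine ⟨drawCount a X n ω 0, (congrFun hω 0).trans ?_⟩
      push_cast
      ring
  · refine minimalLp_le_of_coupling hsnd hYm hπ
      (φ := fun k i => (α i + k i) / (A + n)) ?_ hXY ?_ p
    · exact measurable_pi_iff.2 fun i => ((hcast i).const_add _).div_const _
    · filter_upwards [hw, hb] with z hz1 hz2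
      exact sum_abs_div_sub_le hn0 (fun i => (hα i).le) hz1.1 hz1.2 hz2
  · refine (hcle (h := 1 / n) ?_).trans (hlow (1 / n) (by positivity) ?_ 0 _ ?_ p hp)
    · gcongr; linarith
    · rw [div_le_one hn0]; exact hn1
    · rw [ae_map_iff hYm'.aemeasurable (hlat _ _)]
      refine Filter.Eventually.of_forall fun ω => ⟨drawCount a X n ω 0, ?_⟩
      push_cast
      ring
  · refine minimalLp_le_of_coupling hsnd hYm hπ (φ := fun k i => (k i : ℝ) / n) ?_
      (Filter.Eventually.of_forall fun ω => rfl) ?_ p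
    · exact measurable_pi_iff.2 fun i => (hcast i).div_const _
    · filter_upwards [hw, hb] with z hz1 hz2
      -- With zero initial weights the normalised composition is the empirical frequency.
      have h0 := sum_abs_div_sub_le (α := fun _ => 0) hn0 (fun _ => le_rfl) hz1.1 hz1.2 hz2
      simp only [Finset.sum_const_zero, zero_add, mul_zero, add_zero] at h0
      refine h0.trans ?_
      gcongr
      linarith
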